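/- Let $\mathbb K\in\{\mathbb R,\mathbb C\}$, $\mathbb N=\{1,2,\dots\}$, and let $V=(v^{(m)})_{m\in\mathbb N}$ be a decreasing sequence of strictly positive weights, i.e. $v^{(m)}\in(0,\infty)^{\mathbb N}$ and $v^{(m)}_j\ge v^{(m+1)}_j$ for all $m,j$. For $1\le p<\infty$ let $\ell_p(v^{(m)})=\{x\in\mathbb K^{\mathbb N}: (x_jv^{(m)}_j)_j\in\ell_p\}$ with the norm $\|(x_jv_j^{(m)})_j\|_{\ell_p}$, and let $c_0(v^{(m)})=\{x\in\mathbb K^{\mathbb N}:(x_jv^{(m)}_j)_j\in c_0\}$ with the norm $\sup_j|x_j|v^{(m)}_j$. The Köthe coechelon space $k_p(V)$ is $\bigcup_m\ell_p(v^{(m)})$ for $1\le p<\infty$, and $\bigcup_m c_0(v^{(m)})$ for $p=0$, with the finest locally convex topology for which the inclusions of all steps are continuous. Let $\bar V$ be the set of all $\bar v\in[0,\infty)^{\mathbb N}$ such that for every $m$ there is $\alpha_m>0$ with $\bar v_j\le\alpha_mv^{(m)}_j$ for all $j$. Let $\lambda_2(A(V))=\{x\in\mathbb K^{\mathbb N}:\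 (x_j/v^{(m)}_j)_j\in\ell_2\text{ for all }m\}$ with the topology given by the norms $\|(x_j/v^{(m)}_j)_j\|_{\ell_2}$, $m\in\mathbb N$. For a continuous linear operator $T$ on a topological vector space $E$ and non-empty open sets $U,W\subseteq E$ put $N_T(U,W)=\{n\in\mathbb N: T^n(U)\cap W\ne\emptyset\}$. A set $A\subseteq\mathbb N$ is syndetic if there is $p\in\mathbb N$ such that $\{n,\dots,n+p\}$ meets $A$ for every $n\in\mathbb N$, and thick if for every $p\in\mathbb N$ it contains a set $\{j,j+1,\dots,j+p\}$ with $j\in\mathbb N$. $T$ is transitive, mixing, or topologically ergodic if $N_T(U,W)$ is non-empty, cofinite in $\mathbb N$, or syndetic, respectively, for all non-empty open $U,W$. $T$ is hypercyclic (sequentially hypercyclic) if some orbit $\{x,Tx,T^2x,\dots\}$ is dense (respectively sequentially dense, i.e. every point of $E$ is the limit of a sequence in this orbit). A linear map is compact if it maps some zero neighbourhood to a relatively compact set; a continuous linear map is Montel if it maps bounded sets to relatively compact sets. **Theorem.** Let $p\in\{0\}\cup[1,\infty)$ and suppose that the backward shift $B(x_1,x_2,\dots)=(x_2,x_3,\dots)$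 is a well-defined continuous operator on $k_p(V)$. (a) $B$ is transitive on $k_p(V)$ if and only if there is $m\in\mathbb N$ with $\liminf_{j\to\infty}v^{(m)}_j=0$. (b) The following are equivalent: (i) $B$ is sequentially hypercyclic on $k_p(V)$; (ii) $B$ is hypercyclic on $k_p(V)$; (iii) there are $m\in\mathbb N$ and a thick set $I\subseteq\mathbb N$ with $\lim_{I\ni j\to\infty}v^{(m)}_j=0$. (c) The following are equivalent: (i) $B$ is mixing on $k_p(V)$; (ii) for every infinite set $I\subseteq\mathbb N$ there is $m\in\mathbb N$ with $\liminf_{I\ni j\to\infty}v^{(m)}_j=0$; (iii) $\lim_{j\to\infty}\bar v_j=0$ for every $\bar v\in\bar V$; (iv) the natural map $\ell_2\to k_2(V)$, $x\mapsto x$, is well-defined and compact; (v) the natural map $\lambda_2(A(V))\to\ell_2$, $x\mapsto x$, is well-defined and Montel. (d) If there is $m\in\mathbb N$ such that $\{j\in\mathbb N: v^{(m)}_j<\varepsilon\}$ is syndetic for every $\varepsilon>0$, then $B$ is topologically ergodic on $k_p(V)$. -/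

import Mathlib

open Filter Topology
open scoped ENNReal

noncomputable section

namespace Koethe

/-! ### Subsets of the natural numbers

Sequences are indexed by `ℕ = {0, 1, 2, …}`; the index `j` here is the index `j + 1` of the
convention `ℕ = {1, 2, …}`. -/

/-- A set is thick if it contains arbitrarily long intervals. -/
def IsThick (I : Set ℕ) : Prop :=
  ∀ p : ℕ, ∃ j : ℕ, Set.Icc j (j + p) ⊆ I

/-- A set is syndetic if some `p` is such that every interval `{n, …, n + p}` meets it. -/
def IsSyndetic (A : Set ℕ) : Prop :=
  ∃ p : ℕ, ∀ n : ℕ, (Set.Icc n (n + p) ∩ A).Nonempty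

/-! ### Dynamical properties -/

section Dynamics

variable {E : Type*} [TopologicalSpace E]

/-- The set of all `n ≥ 1` such that `T^n(U)` meets `W`. -/
def returnSet (T : E → E) (U W : Set E) : Set ℕ :=
  {n | 1 ≤ n ∧ (T^[n] '' U ∩ W).Nonempty}

def IsTransitive (T : E → E) : Prop :=
  ∀ U W : Set E, IsOpen U → U.Nonempty → IsOpen W → W.Nonempty → (returnSet T U W).Nonempty

def IsMixing (T : E → E) : Prop :=
  ∀ U W : Set E, IsOpen U → U.Nonempty → IsOpen W → W.Nonempty →
    ({n | 1 ≤ n} \ returnSet T U W).Finite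

def IsTopologicallyErgodic (T : E → E) : Prop :=
  ∀ U W : Set E, IsOpen U → U.Nonempty → IsOpen W → W.Nonempty → IsSyndetic (returnSet T U W)

/-- The orbit of `x`, including `x` itself. -/
def orbit (T : E → E) (x : E) : Set E := Set.range fun n : ℕ => T^[n] x

/-- Some orbit is dense. -/
def IsHypercyclic (T : E → E) : Prop := ∃ x, Dense (orbit T x)

/-- Some orbit is sequentially dense: every point is the limit of a sequence in that orbit. -/
def IsSequentiallyHypercyclic (T : E → E) : Prop := ∃ x, seqClosure (orbit T x) = Set.univ

end Dynamics

/-- A linear map that sends (von Neumann) bounded sets to relatively compact sets. -/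
def IsMontelMap {𝕜 E F : Type*} [RCLike 𝕜] [AddCommGroup E] [Module 𝕜 E] [TopologicalSpace E]
    [AddCommGroup F] [Module 𝕜 F] [TopologicalSpace F] (f : E →L[𝕜] F) : Prop :=
  ∀ S : Set E, Bornology.IsVonNBounded 𝕜 S → IsCompact (closure (f '' S))

/-! ### Weighted sequence spaces -/

/-- The admissible exponents `p ∈ {0} ∪ [1, ∞)`. -/
def Exponent : Type := {p : ℝ // p = 0 ∨ 1 ≤ p}

/-- The exponent `2`. -/
def Exponent.two : Exponent := ⟨2, Or.inr one_le_two⟩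

/-- The exponent of the norm that is used for `p`: the `p`-norm for `p ≥ 1`, and the supremum norm
for `p = 0`. -/
def Exponent.normExponent (p : Exponent) : ℝ≥0∞ :=
  if p.1 = 0 then ∞ else ENNReal.ofReal p.1

instance (p : Exponent) : Fact (1 ≤ p.normExponent) := ⟨by
  unfold Exponent.normExponent
  split_ifs with h
  · exact le_top
  · exact ENNReal.one_le_ofReal.2 (p.2.resolve_left h)⟩

variable (𝕜 : Type*) [RCLike 𝕜]

/-- Multiplication of a scalar sequence by a real weight. -/
def weightMul (v : ℕ → ℝ) : (ℕ → 𝕜) →ₗ[𝕜] (ℕ → 𝕜) where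
  toFun x j := (v j : 𝕜) * x j
  map_add' x y := by ext j; simp [mul_add]
  map_smul' c x := by ext j; simp [mul_left_comm]

/-- The sequences `x` with `(v_j x_j)_j ∈ ℓ_p` for `p ≥ 1`, and with `(v_j x_j)_j ∈ c_0` for
`p = 0` (a null sequence is bounded, so that then the first clause follows from the second). -/
def weightedSubmodule (p : Exponent) (v : ℕ → ℝ) : Submodule 𝕜 (ℕ → 𝕜) where
  carrier := {x | Memℓp (weightMul 𝕜 v x) p.normExponent ∧
    (p.1 = 0 → Tendsto (weightMul 𝕜 v x) atTop (𝓝 0))}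
  zero_mem' := by
    refine ⟨?_, fun _ => ?_⟩
    · rw [map_zero]; exact zero_memℓp
    · rw [map_zero]; exact tendsto_const_nhds
  add_mem' := by
    rintro x y ⟨hx, hx'⟩ ⟨hy, hy'⟩
    refine ⟨?_, fun h => ?_⟩
    · rw [map_add]; exact hx.add hy
    · rw [map_add]; simpa [Pi.add_def] using (hx' h).add (hy' h)
  smul_mem' := by
    rintro c x ⟨hx, hx'⟩
    refine ⟨?_, fun h => ?_⟩
    · rw [map_smul]; exact hx.const_smul c
    · rw [map_smul]; simpa [Pi.smul_def] using (hx' h).const_smul c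

/-- The weighted space `ℓ_p(v)` for `p ≥ 1`, respectively `c_0(v)` for `p = 0`. It is a type of
its own, since it does not carry the topology of coordinatewise convergence. -/
def WeightedSpace (p : Exponent) (v : ℕ → ℝ) : Type _ := ↥(weightedSubmodule 𝕜 p v)

instance (p : Exponent) (v : ℕ → ℝ) : AddCommGroup (WeightedSpace 𝕜 p v) :=
  inferInstanceAs (AddCommGroup ↥(weightedSubmodule 𝕜 p v))

instance (p : Exponent) (v : ℕ → ℝ) : Module 𝕜 (WeightedSpace 𝕜 p v) :=
  inferInstanceAs (Module 𝕜 ↥(weightedSubmodule 𝕜 p v))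

/-- The map `x ↦ (v_j x_j)_j` into Mathlib's `ℓ_p`, respectively `ℓ_∞`. -/
def WeightedSpace.toLp (p : Exponent) (v : ℕ → ℝ) :
    WeightedSpace 𝕜 p v →ₗ[𝕜] lp (fun _ : ℕ => 𝕜) p.normExponent where
  toFun x := ⟨weightMul 𝕜 v x.1, x.2.1⟩
  map_add' x y := Subtype.ext ((weightMul 𝕜 v).map_add x.1 y.1)
  map_smul' c x := Subtype.ext ((weightMul 𝕜 v).map_smul c x.1)

/-- The norm `‖x‖ = ‖(v_j x_j)_j‖` of `ℓ_p(v)`, respectively `c_0(v)` (it is a norm when all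
`v_j` are positive). -/
instance (p : Exponent) (v : ℕ → ℝ) : SeminormedAddCommGroup (WeightedSpace 𝕜 p v) :=
  SeminormedAddCommGroup.induced _ _ (WeightedSpace.toLp 𝕜 p v)

/-! ### Köthe coechelon spaces -/

/-- A decreasing sequence `V = (v^{(m)})_m` of strictly positive weights. -/
structure WeightSequence where
  weight : ℕ → ℕ → ℝ
  pos : ∀ m j, 0 < weight m j
  anti : ∀ m j, weight (m + 1) j ≤ weight m j

theorem WeightSequence.weight_le (V : WeightSequence) {m n : ℕ} (h : m ≤ n) (j : ℕ) :
    V.weight n j ≤ V.weight m j :=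
  antitone_nat_of_succ_le (f := fun k => V.weight k j) (fun k => V.anti k j) h

theorem weightedSubmodule_mono (p : Exponent) (V : WeightSequence) {m n : ℕ} (h : m ≤ n) :
    weightedSubmodule 𝕜 p (V.weight m) ≤ weightedSubmodule 𝕜 p (V.weight n) := by
  have key : ∀ (x : ℕ → 𝕜) (j : ℕ),
      ‖weightMul 𝕜 (V.weight n) x j‖ ≤ ‖weightMul 𝕜 (V.weight m) x j‖ := by
    intro x j
    simp only [weightMul, LinearMap.coe_mk, AddHom.coe_mk, norm_mul, RCLike.norm_ofReal,
      abs_of_pos (V.pos _ _)]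
    exact mul_le_mul_of_nonneg_right (V.weight_le h j) (norm_nonneg _)
  rintro x ⟨hx, hx'⟩
  refine ⟨?_, fun h0 => squeeze_zero_norm (key x) (by simpa using (hx' h0).norm)⟩
  exact hx.mono' (fun j => key x j)

/-- The union of the spaces `ℓ_p(v^{(m)})`, respectively `c_0(v^{(m)})`. -/
def coechelonSubmodule (p : Exponent) (V : WeightSequence) : Submodule 𝕜 (ℕ → 𝕜) where
  carrier := {x | ∃ m, x ∈ weightedSubmodule 𝕜 p (V.weight m)}
  zero_mem' := ⟨0, Submodule.zero_mem _⟩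
  add_mem' := by
    rintro x y ⟨m, hm⟩ ⟨n, hn⟩
    exact ⟨max m n, Submodule.add_mem _ (weightedSubmodule_mono 𝕜 p V (le_max_left m n) hm)
      (weightedSubmodule_mono 𝕜 p V (le_max_right m n) hn)⟩
  smul_mem' := by
    rintro c x ⟨m, hm⟩
    exact ⟨m, Submodule.smul_mem _ c hm⟩

/-- The Köthe coechelon space `k_p(V)`. -/
def CoechelonSpace (p : Exponent) (V : WeightSequence) : Type _ := ↥(coechelonSubmodule 𝕜 p V)

namespace CoechelonSpace

variable (p : Exponent) (V : WeightSequence)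

instance : AddCommGroup (CoechelonSpace 𝕜 p V) :=
  inferInstanceAs (AddCommGroup ↥(coechelonSubmodule 𝕜 p V))

instance : Module 𝕜 (CoechelonSpace 𝕜 p V) :=
  inferInstanceAs (Module 𝕜 ↥(coechelonSubmodule 𝕜 p V))

instance : Module ℝ (CoechelonSpace 𝕜 p V) :=
  inferInstanceAs (Module ℝ ↥(coechelonSubmodule 𝕜 p V))

instance : CoeFun (CoechelonSpace 𝕜 p V) (fun _ => ℕ → 𝕜) := ⟨fun x => x.1⟩

/-- The inclusion of the `m`-th step. -/
def incl (m : ℕ) : WeightedSpace 𝕜 p (V.weight m) →ₗ[𝕜] CoechelonSpace 𝕜 p V where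
  toFun x := ⟨x.1, m, x.2⟩
  map_add' _ _ := rfl
  map_smul' _ _ := rfl

/-- The locally convex vector space topologies for which all inclusions of the steps are
continuous. -/
def admissibleTopologies : Set (TopologicalSpace (CoechelonSpace 𝕜 p V)) :=
  {t | @IsTopologicalAddGroup _ t _ ∧ @ContinuousSMul 𝕜 _ _ _ t ∧
    @LocallyConvexSpace ℝ _ _ _ _ _ t ∧
    ∀ m, @Continuous _ _ _ t (incl 𝕜 p V m)}

/-- The inductive limit topology, that is, the finest admissible topology. (In Mathlib's order,
finer topologies are smaller.) -/
instance : TopologicalSpace (CoechelonSpace 𝕜 p V) := sInf (admissibleTopologies 𝕜 p V)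

/-- The infimum is attained, so that the topology is indeed the finest admissible one. -/
theorem topology_mem_admissibleTopologies :
    (inferInstance : TopologicalSpace (CoechelonSpace 𝕜 p V)) ∈ admissibleTopologies 𝕜 p V :=
  ⟨topologicalAddGroup_sInf fun _ h => h.1, continuousSMul_sInf fun _ h => h.2.1,
    LocallyConvexSpace.sInf fun _ h => h.2.2.1,
    fun m => continuous_sInf_rng.2 fun _ h => h.2.2.2 m⟩

end CoechelonSpace

/-- The family `V̄` of weights of the projective description of `V`. -/
def projectiveWeights (V : WeightSequence) : Set (ℕ → ℝ) :=
  {u | (∀ j, 0 ≤ u j) ∧ ∀ m, ∃ α : ℝ, 0 < α ∧ ∀ j, u j ≤ α * V.weight m j}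

/-! ### Köthe echelon spaces of order two -/

/-- The Köthe matrix `A(V)` with the entries `1 / v^{(m)}_j`. -/
def koetheMatrix (V : WeightSequence) : ℕ → ℕ → ℝ := fun m j => 1 / V.weight m j

/-- The sequences `x` with `(a^{(m)}_j x_j)_j ∈ ℓ_2` for every `m`. -/
def echelonSubmodule (A : ℕ → ℕ → ℝ) : Submodule 𝕜 (ℕ → 𝕜) where
  carrier := {x | ∀ m, Memℓp (weightMul 𝕜 (A m) x) 2}
  zero_mem' m := by rw [map_zero]; exact zero_memℓp
  add_mem' hx hy m := by rw [map_add]; exact (hx m).add (hy m)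
  smul_mem' c x hx m := by rw [map_smul]; exact (hx m).const_smul c

/-- The Köthe echelon space `λ_2(A)`. -/
def EchelonSpace (A : ℕ → ℕ → ℝ) : Type _ := ↥(echelonSubmodule 𝕜 A)

namespace EchelonSpace

variable (A : ℕ → ℕ → ℝ)

instance : AddCommGroup (EchelonSpace 𝕜 A) :=
  inferInstanceAs (AddCommGroup ↥(echelonSubmodule 𝕜 A))

instance : Module 𝕜 (EchelonSpace 𝕜 A) :=
  inferInstanceAs (Module 𝕜 ↥(echelonSubmodule 𝕜 A))

instance : CoeFun (EchelonSpace 𝕜 A) (fun _ => ℕ → 𝕜) := ⟨fun x => x.1⟩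

/-- The map `x ↦ (a^{(m)}_j x_j)_j` into `ℓ_2`. -/
def toLp (m : ℕ) : EchelonSpace 𝕜 A →ₗ[𝕜] lp (fun _ : ℕ => 𝕜) 2 where
  toFun x := ⟨weightMul 𝕜 (A m) x.1, x.2 m⟩
  map_add' x y := Subtype.ext ((weightMul 𝕜 (A m)).map_add x.1 y.1)
  map_smul' c x := Subtype.ext ((weightMul 𝕜 (A m)).map_smul c x.1)

/-- The topology of the seminorms `‖x‖_m = ‖(a^{(m)}_j x_j)_j‖_2`. -/
instance : TopologicalSpace (EchelonSpace 𝕜 A) :=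
  ⨅ m, TopologicalSpace.induced (toLp 𝕜 A m) inferInstance

end EchelonSpace

end Koethe

end

noncomputable section

namespace Koethe

section

variable {𝕜 : Type*} [RCLike 𝕜] {p : Exponent} {v : ℕ → ℝ}

/-! ### The steps -/

/-! Everything is read off from the unit vectors `e_j`, here with `j` counted from `0`. Continuity
of the inclusion of the `m`-th step puts `e_j` into a given zero neighbourhood as soon as `v^(m)_j`
is small enough.

Sufficiency in (a), (c), (d). Let `x ∈ U` and `y ∈ W` be finitely supported and `N` larger than both
supports. The vector `x + ∑ y_i e_{i+n}` is sent to `y` by `B^n` when `n ≥ N`. Since `e_{i+n} =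
B^{N-i} e_{n+N}`, continuity of `B` puts it into `U` once the single vector `e_{n+N}` is small
(`exists_mem_returnSet`).

Necessity in (a), (c). If each `v^(m)` is bounded away from zero on `I`, the indicator of `I` lies
in `V̄`, and `sup_{j ∈ I} |x_j|` is a continuous seminorm. A point of its unit ball cannot be moved
into `{|x_0| > 1}` by `B^n` with `n ∈ I` (`exists_returnSet_disjoint`).

For (b), a hypercyclic vector lies in one step, so `v^(m)_j |x_j|` is bounded, while its orbit
produces arbitrarily long intervals where `|x_j|` is large; there the weight is small. Conversely,
blocks from a countable dense family, placed at the ends of long intervals of small weight, give a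
vector whose orbit approximates every point within a single step (`exists_block_sequence`).

For (iv) and (v) in (c), an indicator in `V̄` of an infinite set yields unit vectors contradicting
compactness. In the other direction, the infimum of suitably scaled weights is in `V̄`, hence null,
which gives indices `μ j` with `2^{μ j} C_{μ j} v^(μ j)_j → 0` (`exists_tendsto`). Splitting a
sequence along the level sets of `μ` makes tails uniformly small in the inductive limit, and puts a
bounded set of `λ_2(A(V))` into the image of a ball under a compact diagonal operator. -/

theorem lp_sum_single_apply {q : ℝ≥0∞} [Fact (1 ≤ q)] (s : Finset ℕ) (f : ℕ → 𝕜) (i : ℕ) :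
    (∑ j ∈ s, lp.single (E := fun _ : ℕ => 𝕜) q j (f j)) i = if i ∈ s then f i else 0 := by
  rw [lp.coeFn_sum, Finset.sum_apply]
  split_ifs with hi
  · rw [Finset.sum_eq_single_of_mem i hi, lp.single_apply_self]
    exact fun j _ hj => lp.single_apply_ne _ _ _ hj.symm
  · exact Finset.sum_eq_zero fun j hj => lp.single_apply_ne _ _ _ fun h => hi (h ▸ hj)

theorem Exponent.normExponent_ne_zero (p : Exponent) : p.normExponent ≠ 0 :=
  (zero_lt_one.trans_le (Fact.out : 1 ≤ p.normExponent)).ne'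

theorem Exponent.normExponent_ne_top {p : Exponent} (h : p.1 ≠ 0) : p.normExponent ≠ ∞ := by
  simp [normExponent, h]

theorem Exponent.normExponent_of_eq_zero {p : Exponent} (h : p.1 = 0) : p.normExponent = ∞ := by
  simp [normExponent, h]

theorem Exponent.normExponent_two : Exponent.two.normExponent = 2 := by
  simp [normExponent, two]

@[simp] theorem weightMul_apply (v : ℕ → ℝ) (x : ℕ → 𝕜) (j : ℕ) :
    weightMul 𝕜 v x j = (v j : 𝕜) * x j := rfl

theorem mem_weightedSubmodule_of_finite {x : ℕ → 𝕜} {N : ℕ} (hx : ∀ j, N ≤ j → x j = 0) :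
    x ∈ weightedSubmodule 𝕜 p v := by
  refine ⟨Memℓp.of_exponent_ge (memℓp_zero ?_) zero_le, fun _ => ?_⟩
  · refine (Set.finite_lt_nat N).subset fun j hj => ?_
    by_contra hN
    exact hj (by simp [hx j (not_lt.1 hN)])
  · refine tendsto_const_nhds.congr' ?_
    filter_upwards [eventually_ge_atTop N] with j hj
    simp [hx j hj]

theorem WeightedSpace.norm_apply_le (x : WeightedSpace 𝕜 p v) (j : ℕ) :
    ‖(v j : 𝕜) * x.1 j‖ ≤ ‖x‖ :=
  lp.norm_apply_le_norm p.normExponent_ne_zero (WeightedSpace.toLp 𝕜 p v x) j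

/-- The sequence that agrees with `x` below `N` and vanishes from `N` on. -/
def truncate (N : ℕ) (x : ℕ → 𝕜) (j : ℕ) : 𝕜 := if j < N then x j else 0

theorem truncate_of_le {N j : ℕ} (x : ℕ → 𝕜) (h : N ≤ j) : truncate N x j = 0 := if_neg h.not_gt

/-- A sequence in the weighted submodule, as an element of the weighted space. -/
def WeightedSpace.mk (x : ℕ → 𝕜) (hx : x ∈ weightedSubmodule 𝕜 p v) : WeightedSpace 𝕜 p v :=
  ⟨x, hx⟩

/-- A finitely supported sequence, as an element of a step. -/
def WeightedSpace.ofFinite (p : Exponent) (v : ℕ → ℝ) (x : ℕ → 𝕜) {N : ℕ}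
    (hx : ∀ j, N ≤ j → x j = 0) : WeightedSpace 𝕜 p v :=
  mk x (mem_weightedSubmodule_of_finite hx)

/-- The `ℓ_1`-norm dominates all the norms involved, so later estimates need no distinction between
values of `p`. -/
theorem WeightedSpace.norm_le_sum (x : WeightedSpace 𝕜 p v) {s : Finset ℕ}
    (hs : ∀ j ∉ s, x.1 j = 0) : ‖x‖ ≤ ∑ j ∈ s, ‖(v j : 𝕜) * x.1 j‖ := by
  have h : WeightedSpace.toLp 𝕜 p v x =
      ∑ j ∈ s, lp.single p.normExponent j ((v j : 𝕜) * x.1 j) := by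
    refine lp.ext (funext fun i => ?_)
    rw [lp_sum_single_apply s fun j => (v j : 𝕜) * x.1 j]
    change (v i : 𝕜) * x.1 i = _
    split_ifs with hi
    · rfl
    · rw [hs i hi, mul_zero]
  calc ‖x‖ = ‖WeightedSpace.toLp 𝕜 p v x‖ := rfl
    _ ≤ _ := by
      rw [h]
      refine (norm_sum_le _ _).trans (Finset.sum_le_sum fun j _ => ?_)
      rw [lp.norm_single (pos_iff_ne_zero.2 p.normExponent_ne_zero)]

theorem WeightedSpace.tendsto_truncate (x : WeightedSpace 𝕜 p v) :
    Tendsto (fun N => ofFinite p v (truncate N x.1) fun _ => truncate_of_le x.1) atTop (𝓝 x) := by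
  rw [tendsto_iff_norm_sub_tendsto_zero]
  by_cases hp : p.1 = 0
  · rw [Metric.tendsto_atTop]
    intro ε hε
    obtain ⟨N, hN⟩ := Metric.tendsto_atTop.1 (x.2.2 hp) (ε / 2) (half_pos hε)
    refine ⟨N, fun n hn => ?_⟩
    rw [dist_zero_right, norm_norm]
    refine lt_of_le_of_lt ?_ (half_lt_self hε)
    -- The exponent equals `∞` only propositionally; a variable `q` allows substitution.
    have key : ∀ q : ℝ≥0∞, q = ∞ → ∀ f : lp (fun _ : ℕ => 𝕜) q, (∀ i, ‖f i‖ ≤ ε / 2) →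
        ‖f‖ ≤ ε / 2 := by
      rintro q rfl f hf
      exact lp.norm_le_of_forall_le (half_pos hε).le hf
    refine key _ (Exponent.normExponent_of_eq_zero hp) (WeightedSpace.toLp 𝕜 p v _) fun i => ?_
    change ‖(v i : 𝕜) * (truncate n x.1 i - x.1 i)‖ ≤ _
    by_cases hi : i < n
    · simp [truncate, hi, (half_pos hε).le]
    · have := (hN i (hn.trans (not_lt.1 hi))).le
      simpa [truncate, hi] using this
  · have h := (lp.hasSum_single (Exponent.normExponent_ne_top hp)
      (WeightedSpace.toLp 𝕜 p v x)).tendsto_sum_nat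
    rw [tendsto_iff_norm_sub_tendsto_zero] at h
    refine h.congr fun N => ?_
    change _ = ‖WeightedSpace.toLp 𝕜 p v _‖
    congr 1
    refine lp.ext (funext fun i => ?_)
    change _ = (v i : 𝕜) * (truncate N x.1 i - x.1 i)
    rw [lp.coeFn_sub, Pi.sub_apply, mul_sub, lp_sum_single_apply]
    congr 1
    simp only [truncate, Finset.mem_range, mul_ite, mul_zero]
    rfl

/-! ### The inductive limit -/

namespace CoechelonSpace

variable {V : WeightSequence}

instance : IsTopologicalAddGroup (CoechelonSpace 𝕜 p V) :=
  (topology_mem_admissibleTopologies 𝕜 p V).1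

instance : ContinuousSMul 𝕜 (CoechelonSpace 𝕜 p V) :=
  (topology_mem_admissibleTopologies 𝕜 p V).2.1

instance : LocallyConvexSpace ℝ (CoechelonSpace 𝕜 p V) :=
  (topology_mem_admissibleTopologies 𝕜 p V).2.2.1

instance : IsScalarTower ℝ 𝕜 (CoechelonSpace 𝕜 p V) :=
  inferInstanceAs (IsScalarTower ℝ 𝕜 ↥(coechelonSubmodule 𝕜 p V))

instance : ContinuousSMul ℝ (CoechelonSpace 𝕜 p V) := IsScalarTower.continuousSMul 𝕜

theorem continuous_incl (m : ℕ) : Continuous (incl 𝕜 p V m) :=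
  (topology_mem_admissibleTopologies 𝕜 p V).2.2.2 m

/-- The topology induced by `f` is itself admissible, so the finest admissible topology refines it.
-/
theorem continuous_of_steps {F : Type*} [SeminormedAddCommGroup F] [NormedSpace 𝕜 F]
    [NormedSpace ℝ F] [IsScalarTower ℝ 𝕜 F] (f : CoechelonSpace 𝕜 p V →ₗ[𝕜] F)
    (hf : ∀ m, Continuous (f ∘ incl 𝕜 p V m)) : Continuous f := by
  rw [continuous_iff_le_induced]
  refine sInf_le ⟨topologicalAddGroup_induced f, continuousSMul_induced f,
    LocallyConvexSpace.induced (f.restrictScalars ℝ), fun m => continuous_induced_rng.2 (hf m)⟩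

theorem continuous_of_bound_steps {F : Type*} [SeminormedAddCommGroup F] [NormedSpace 𝕜 F]
    [NormedSpace ℝ F] [IsScalarTower ℝ 𝕜 F] (f : CoechelonSpace 𝕜 p V →ₗ[𝕜] F)
    (hf : ∀ m, ∃ C, ∀ x, ‖f (incl 𝕜 p V m x)‖ ≤ C * ‖x‖) : Continuous f := by
  refine continuous_of_steps f fun m => ?_
  obtain ⟨C, hC⟩ := hf m
  exact AddMonoidHomClass.continuous_of_bound (f ∘ₗ incl 𝕜 p V m) C hC

/-- The diagonal operator with symbol `u`, with values in `ℓ_∞`. -/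
def diagonal (u : ℕ → ℝ) (hu : u ∈ projectiveWeights V) :
    CoechelonSpace 𝕜 p V →ₗ[𝕜] lp (fun _ : ℕ => 𝕜) ∞ where
  toFun x := ⟨weightMul 𝕜 u x.1, by
    obtain ⟨m, hm⟩ := x.2
    obtain ⟨α, hα, h⟩ := hu.2 m
    refine memℓp_infty ⟨α * ‖WeightedSpace.mk x.1 hm‖, ?_⟩
    rintro _ ⟨j, rfl⟩
    refine le_trans ?_ (mul_le_mul_of_nonneg_left (WeightedSpace.norm_apply_le _ j) hα.le)
    simp only [weightMul_apply, norm_mul, RCLike.norm_ofReal, abs_of_nonneg (hu.1 j),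
      abs_of_pos (V.pos m j), ← mul_assoc]
    exact mul_le_mul_of_nonneg_right (h j) (norm_nonneg _)⟩
  map_add' x y := Subtype.ext ((weightMul 𝕜 u).map_add x.1 y.1)
  map_smul' c x := Subtype.ext ((weightMul 𝕜 u).map_smul c x.1)

theorem diagonal_apply (u : ℕ → ℝ) (hu : u ∈ projectiveWeights V) (x : CoechelonSpace 𝕜 p V)
    (j : ℕ) : diagonal (𝕜 := 𝕜) (p := p) u hu x j = (u j : 𝕜) * x j := rfl

theorem continuous_diagonal (u : ℕ → ℝ) (hu : u ∈ projectiveWeights V) :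
    Continuous (diagonal (𝕜 := 𝕜) (p := p) u hu) := by
  refine continuous_of_bound_steps _ fun m => ?_
  obtain ⟨α, hα, h⟩ := hu.2 m
  refine ⟨α, fun x => lp.norm_le_of_forall_le (by positivity) fun j => ?_⟩
  refine le_trans ?_ (mul_le_mul_of_nonneg_left (WeightedSpace.norm_apply_le x j) hα.le)
  change ‖(u j : 𝕜) * x.1 j‖ ≤ _
  simp only [norm_mul, RCLike.norm_ofReal, abs_of_nonneg (hu.1 j),
    abs_of_pos (V.pos m j), ← mul_assoc]
  exact mul_le_mul_of_nonneg_right (h j) (norm_nonneg _)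

theorem continuous_apply (j : ℕ) : Continuous fun x : CoechelonSpace 𝕜 p V => x j := by
  let f : CoechelonSpace 𝕜 p V →ₗ[𝕜] 𝕜 :=
    { toFun := fun x => x j, map_add' := fun _ _ => rfl, map_smul' := fun _ _ => rfl }
  refine continuous_of_bound_steps f fun m => ⟨(V.weight m j)⁻¹, fun x => ?_⟩
  have h := WeightedSpace.norm_apply_le x j
  rw [norm_mul, RCLike.norm_ofReal, abs_of_pos (V.pos m j)] at h
  change ‖x.1 j‖ ≤ _
  rwa [inv_mul_eq_div, le_div_iff₀' (V.pos m j)]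

@[ext] theorem ext {x y : CoechelonSpace 𝕜 p V} (h : ∀ j, x j = y j) : x = y :=
  Subtype.ext (funext h)

@[simp] theorem add_apply (x y : CoechelonSpace 𝕜 p V) (j : ℕ) : (x + y) j = x j + y j := rfl
@[simp] theorem zero_apply (j : ℕ) : (0 : CoechelonSpace 𝕜 p V) j = 0 := rfl
@[simp] theorem smul_apply (c : 𝕜) (x : CoechelonSpace 𝕜 p V) (j : ℕ) : (c • x) j = c * x j := rfl

theorem sum_apply {ι : Type*} (s : Finset ι) (x : ι → CoechelonSpace 𝕜 p V) (j : ℕ) :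
    (∑ i ∈ s, x i) j = ∑ i ∈ s, x i j := by
  classical
  induction s using Finset.induction_on with
  | empty => simp
  | insert a s ha ih => rw [Finset.sum_insert ha, Finset.sum_insert ha, add_apply, ih]

/-- A finitely supported sequence, as an element of `k_p(V)`. -/
def ofFinite (x : ℕ → 𝕜) {N : ℕ} (hx : ∀ j, N ≤ j → x j = 0) : CoechelonSpace 𝕜 p V :=
  ⟨x, 0, mem_weightedSubmodule_of_finite hx⟩

theorem tendsto_truncate (x : CoechelonSpace 𝕜 p V) :
    Tendsto (fun N => (ofFinite (truncate N x) fun _ => truncate_of_le x :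
      CoechelonSpace 𝕜 p V)) atTop (𝓝 x) := by
  obtain ⟨m, hm⟩ := x.2
  exact ((continuous_incl m).tendsto _).comp
    (WeightedSpace.tendsto_truncate (WeightedSpace.mk x.1 hm))

theorem exists_finite_mem {U : Set (CoechelonSpace 𝕜 p V)} (hU : IsOpen U) (hne : U.Nonempty) :
    ∃ x ∈ U, ∃ N, ∀ j, N ≤ j → x j = 0 := by
  obtain ⟨x, hx⟩ := hne
  obtain ⟨N, hN⟩ := ((tendsto_truncate x).eventually (hU.mem_nhds hx)).exists
  exact ⟨_, hN, N, fun j hj => truncate_of_le x hj⟩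

/-- The unit vectors. -/
def unit (j : ℕ) : CoechelonSpace 𝕜 p V :=
  ofFinite (Pi.single j 1 : ℕ → 𝕜) (N := j + 1) fun i hi => by
    rw [Pi.single_eq_of_ne (by omega)]

theorem unit_apply (i j : ℕ) : (unit i : CoechelonSpace 𝕜 p V) j = if j = i then 1 else 0 := by
  change (Pi.single i 1 : ℕ → 𝕜) j = _
  rw [Pi.single_apply]

/-- If the `m`-th weight is small at `j`, then so is the `j`-th unit vector. -/
theorem exists_unit_mem {O : Set (CoechelonSpace 𝕜 p V)} (hO : O ∈ 𝓝 0) (m : ℕ) :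
    ∃ ε > 0, ∀ j, V.weight m j < ε → unit j ∈ O := by
  have h := (continuous_incl (𝕜 := 𝕜) (p := p) (V := V) m).tendsto 0
  rw [map_zero] at h
  obtain ⟨ε, hε, h⟩ := Metric.mem_nhds_iff.1 (h hO)
  refine ⟨ε, hε, fun j hj => ?_⟩
  refine @h (WeightedSpace.ofFinite p (V.weight m) (Pi.single j 1 : ℕ → 𝕜) (N := j + 1)
    fun i hi => by rw [Pi.single_eq_of_ne (by omega)]) ?_
  rw [mem_ball_zero_iff]
  refine (WeightedSpace.norm_le_sum _ (s := {j}) fun i hi => ?_).trans_lt ?_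
  · exact Pi.single_eq_of_ne (by simpa using hi) _
  · simpa [WeightedSpace.ofFinite, WeightedSpace.mk, abs_of_pos (V.pos m j)] using hj

end CoechelonSpace

end

section

/-! ### Null sequences along filters -/

/-- In `EReal` the lower limit is meaningful for unbounded weights too; positivity reduces its
vanishing to an upper bound. -/
theorem liminf_coe_eq_zero_iff {l : Filter ℕ} [l.NeBot] {f : ℕ → ℝ} (hf : ∀ j, 0 < f j) :
    liminf (fun j => (f j : EReal)) l = 0 ↔ ∀ ε > 0, ∃ᶠ j in l, f j < ε := by
  have h0 : 0 ≤ liminf (fun j => (f j : EReal)) l :=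
    le_liminf_of_le (by isBoundedDefault) (Eventually.of_forall fun j => by exact_mod_cast (hf j).le)
  constructor
  · intro h ε hε
    have := frequently_lt_of_liminf_lt (f := l) (u := fun j => (f j : EReal)) (b := (ε : EReal))
      (by isBoundedDefault) (by rw [h]; exact_mod_cast hε)
    simpa using this
  · intro h
    refine le_antisymm (le_of_not_gt fun hlt => ?_) h0
    obtain ⟨ε, h1, h2⟩ := EReal.lt_iff_exists_real_btwn.1 hlt
    have h3 := eventually_lt_of_lt_liminf h2 (by isBoundedDefault)
    obtain ⟨j, hj, hj'⟩ := ((h ε (by exact_mod_cast h1)).and_eventually h3).exists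
    exact absurd hj (not_lt.2 (by exact_mod_cast hj'.le))

theorem neBot_atTop_inf_principal {I : Set ℕ} (hI : I.Infinite) : (atTop ⊓ 𝓟 I).NeBot :=
  frequently_mem_iff_neBot.1 (Nat.frequently_atTop_iff_infinite.2 hI)

variable {V : WeightSequence}

/-- The weights tend to zero along subsequences of every infinite set. -/
def WeightSequence.HasNullSubsequences (V : WeightSequence) : Prop :=
  ∀ I : Set ℕ, I.Infinite → ∃ m, ∀ ε > 0, ∃ j ∈ I, V.weight m j < ε

theorem indicator_mem_projectiveWeights {I : Set ℕ} {c : ℕ → ℝ} (hc : ∀ m, 0 < c m)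
    (h : ∀ m, ∀ j ∈ I, c m ≤ V.weight m j) : I.indicator 1 ∈ projectiveWeights V := by
  refine ⟨fun j => Set.indicator_nonneg (fun _ _ => zero_le_one) j, fun m => ⟨(c m)⁻¹, ?_, ?_⟩⟩
  · exact inv_pos.2 (hc m)
  · intro j
    by_cases hj : j ∈ I
    · rw [Set.indicator_of_mem hj, Pi.one_apply, ← div_eq_inv_mul, one_le_div (hc m)]
      exact h m j hj
    · rw [Set.indicator_of_notMem hj]
      exact mul_nonneg (inv_pos.2 (hc m)).le (V.pos m j).le

theorem exists_indicator_mem_projectiveWeights (h : ¬ V.HasNullSubsequences) :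
    ∃ I : Set ℕ, I.Infinite ∧ I.indicator 1 ∈ projectiveWeights V := by
  unfold WeightSequence.HasNullSubsequences at h
  push Not at h
  obtain ⟨I, hI, h⟩ := h
  choose c hc h using h
  exact ⟨I, hI, indicator_mem_projectiveWeights hc h⟩

/-- One index per `ε` suffices: a positive weight is bounded below on a finite set, so finitely many
indices cannot serve all `ε`. -/
theorem hasNullSubsequences_iff_liminf : V.HasNullSubsequences ↔ ∀ I : Set ℕ, I.Infinite →
    ∃ m, liminf (fun j => (V.weight m j : EReal)) (atTop ⊓ 𝓟 I) = 0 := by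
  refine forall₂_congr fun I hI => exists_congr fun m => ?_
  have := neBot_atTop_inf_principal hI
  rw [liminf_coe_eq_zero_iff (V.pos m)]
  constructor
  · intro h ε hε
    rw [frequently_inf_principal, Nat.frequently_atTop_iff_infinite]
    intro hfin
    obtain ⟨δ, hδ, hδ'⟩ : ∃ δ > 0, ∀ j ∈ {j | j ∈ I ∧ V.weight m j < ε}, δ ≤ V.weight m j := by
      rcases Set.eq_empty_or_nonempty {j | j ∈ I ∧ V.weight m j < ε} with he | hne
      · exact ⟨1, one_pos, by simp [he]⟩
      · obtain ⟨j, _, hj'⟩ := Set.exists_min_image _ (V.weight m) hfin hne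
        exact ⟨_, V.pos m j, hj'⟩
    obtain ⟨j, hj, hlt⟩ := h (min ε δ) (lt_min hε hδ)
    exact absurd (hlt.trans_le (min_le_right _ _))
      (not_lt.2 (hδ' j ⟨hj, hlt.trans_le (min_le_left _ _)⟩))
  · intro h ε hε
    obtain ⟨j, hj, hj'⟩ := (frequently_inf_principal.1 (h ε hε)).exists
    exact ⟨j, hj, hj'⟩

/-- If `u ≥ ε` on an infinite set, then `v^(m) ≥ ε / α_m` there for every `m`; conversely the
indicator of a bad set is a member of `V̄` that is not null. -/
theorem hasNullSubsequences_iff_projectiveWeights :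
    V.HasNullSubsequences ↔ ∀ u ∈ projectiveWeights V, Tendsto u atTop (𝓝 0) := by
  constructor
  · intro h u hu
    rw [Metric.tendsto_atTop]
    by_contra! hcon
    obtain ⟨ε, hε, hcon⟩ := hcon
    have hI : {j | ε ≤ u j}.Infinite := by
      rw [← Nat.frequently_atTop_iff_infinite, frequently_atTop]
      intro a
      obtain ⟨n, hn, h'⟩ := hcon a
      refine ⟨n, hn, ?_⟩
      rwa [Real.dist_0_eq_abs, abs_of_nonneg (hu.1 n)] at h'
    obtain ⟨m, hm⟩ := h _ hI
    obtain ⟨α, hα, hu'⟩ := hu.2 m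
    obtain ⟨j, hj, hlt⟩ := hm (ε / α) (by positivity)
    rw [lt_div_iff₀' hα] at hlt
    exact absurd (hj.trans (hu' j)) (not_le.2 hlt)
  · intro h
    by_contra hcon
    obtain ⟨I, hI, hu⟩ := exists_indicator_mem_projectiveWeights hcon
    have h1 := (h _ hu).eventually_lt_const zero_lt_one
    obtain ⟨j, hj, hj'⟩ := ((Nat.frequently_atTop_iff_infinite.2 hI).and_eventually h1).exists
    rw [Set.indicator_of_mem hj] at hj'
    exact lt_irrefl _ hj'

/-! ### The return sets of the backward shift -/

namespace CoechelonSpace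

variable {𝕜 : Type*} [RCLike 𝕜] {p : Exponent}
  {B : CoechelonSpace 𝕜 p V →L[𝕜] CoechelonSpace 𝕜 p V}
  (hB : ∀ (x : CoechelonSpace 𝕜 p V) (j : ℕ), (B x) j = x (j + 1))
include hB

theorem iterate_apply (n : ℕ) (x : CoechelonSpace 𝕜 p V) (j : ℕ) : (B^[n] x) j = x (j + n) := by
  induction n generalizing j with
  | zero => rfl
  | succ n ih => rw [Function.iterate_succ_apply', hB, ih, add_right_comm, add_assoc]

theorem exists_mem_returnSet {U W : Set (CoechelonSpace 𝕜 p V)} (hU : IsOpen U)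
    (hU' : U.Nonempty) (hW : IsOpen W) (hW' : W.Nonempty) :
    ∃ O ∈ 𝓝 (0 : CoechelonSpace 𝕜 p V), ∃ N, 1 ≤ N ∧
      ∀ n ≥ N, unit (n + N) ∈ O → n ∈ returnSet B U W := by
  obtain ⟨x, hx, a, ha⟩ := exists_finite_mem hU hU'
  obtain ⟨y, hy, b, hb⟩ := exists_finite_mem hW hW'
  obtain ⟨N, hN⟩ : ∃ N, N = max a b + 1 := ⟨_, rfl⟩
  -- At `z = e_{n+N}` this is `x + ∑ y_i e_{i+n}`. One continuous map handles all `n`, so the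
  -- neighbourhood `O` does not depend on `n`.
  let g : CoechelonSpace 𝕜 p V → CoechelonSpace 𝕜 p V :=
    fun z => x + ∑ i ∈ Finset.range N, y i • B^[N - i] z
  have hg : Continuous g := continuous_const.add
    (continuous_finsetSum _ fun i _ => (continuous_const_smul (y i)).comp (B.continuous.iterate _))
  have hit (k : ℕ) : B^[k] (0 : CoechelonSpace 𝕜 p V) = 0 :=
    Function.iterate_fixed (map_zero B) k
  have hg0 : g 0 = x := by simp [g, hit]
  refine ⟨g ⁻¹' U, hg.continuousAt.preimage_mem_nhds (by rw [hg0]; exact hU.mem_nhds hx), N,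
    by omega, fun n hn hmem => ⟨by omega, y, ⟨_, hmem, ?_⟩, hy⟩⟩
  ext j
  rw [iterate_apply hB, add_apply, ha _ (by omega), zero_add, sum_apply]
  have h : ∀ i ∈ Finset.range N, (y i • B^[N - i] (unit (n + N) : CoechelonSpace 𝕜 p V)) (j + n) =
      if j = i then y i else 0 := by
    intro i hi
    have : j + n + (N - i) = n + N ↔ j = i := by have := Finset.mem_range.1 hi; omega
    rw [smul_apply, iterate_apply hB, unit_apply]
    simp only [this, mul_ite, mul_one, mul_zero]
  rw [Finset.sum_congr rfl h, Finset.sum_ite_eq]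
  split_ifs with hj
  · rfl
  · exact (hb j (by have := Finset.mem_range.not.1 hj; omega)).symm

theorem isTransitive_of_liminf {m : ℕ}
    (h : liminf (fun j => (V.weight m j : EReal)) atTop = 0) : IsTransitive B := by
  intro U W hU hU' hW hW'
  obtain ⟨O, hO, N, -, h'⟩ := exists_mem_returnSet hB hU hU' hW hW'
  obtain ⟨ε, hε, hε'⟩ := exists_unit_mem hO m
  obtain ⟨j, hj, hj'⟩ := frequently_atTop.1 ((liminf_coe_eq_zero_iff (V.pos m)).1 h ε hε) (2 * N)
  refine ⟨j - N, h' _ (by omega) ?_⟩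
  rw [Nat.sub_add_cancel (by omega)]
  exact hε' j hj'

theorem isMixing_of_hasNullSubsequences (h : V.HasNullSubsequences) : IsMixing B := by
  intro U W hU hU' hW hW'
  obtain ⟨O, hO, N, -, h'⟩ := exists_mem_returnSet hB hU hU' hW hW'
  -- An infinite set of exceptional indices would contain some `j` with `v^(m)_j < ε`, and then `e_j
  -- ∈ O`.
  have hfin : {j | (unit j : CoechelonSpace 𝕜 p V) ∉ O}.Finite := by
    by_contra hI
    obtain ⟨m, hm⟩ := h _ hI
    obtain ⟨ε, hε, hε'⟩ := exists_unit_mem hO m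
    obtain ⟨j, hj, hj'⟩ := hm ε hε
    exact hj (hε' j hj')
  refine ((Set.finite_lt_nat N).union (hfin.preimage
    (f := fun n => n + N) fun _ _ _ _ h => Nat.add_right_cancel h)).subset fun n hn => ?_
  by_contra hcon
  simp only [Set.mem_union, Set.mem_ofPred_eq, Set.mem_preimage, not_or, not_lt, not_not] at hcon
  exact hn.2 (h' n hcon.1 hcon.2)

theorem isTopologicallyErgodic_of_isSyndetic {m : ℕ}
    (h : ∀ ε : ℝ, 0 < ε → IsSyndetic {j | V.weight m j < ε}) : IsTopologicallyErgodic B := by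
  intro U W hU hU' hW hW'
  obtain ⟨O, hO, N, -, h'⟩ := exists_mem_returnSet hB hU hU' hW hW'
  obtain ⟨ε, hε, hε'⟩ := exists_unit_mem hO m
  obtain ⟨q, hq⟩ := h ε hε
  -- A small weight at `j ∈ [n + 2N, n + 2N + q]` gives the return time `j - N`, which is at least
  -- `N` and at most `n + q + N`.
  refine ⟨q + N, fun n => ?_⟩
  obtain ⟨j, ⟨h1, h2⟩, h3⟩ := hq (n + 2 * N)
  refine ⟨j - N, ⟨by omega, by omega⟩, h' _ (by omega) ?_⟩
  rw [Nat.sub_add_cancel (by omega)]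
  exact hε' j h3

/-- If the indicator of `I` belongs to `V̄`, then some return set of `B` avoids `I`. -/
theorem exists_returnSet_disjoint {I : Set ℕ} (hI : I.indicator 1 ∈ projectiveWeights V) :
    ∃ U W : Set (CoechelonSpace 𝕜 p V), IsOpen U ∧ U.Nonempty ∧ IsOpen W ∧ W.Nonempty ∧
      Disjoint (returnSet B U W) I := by
  -- Since `(B^n x)_0 = x_n`, for `n ∈ I` the two open sets demand `|x_n| < 1` and `|x_n| > 1`.
  refine ⟨(fun x => ‖diagonal (𝕜 := 𝕜) (p := p) (I.indicator 1) hI x‖) ⁻¹' Set.Iio 1,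
    (fun x => ‖x 0‖) ⁻¹' Set.Ioi 1, isOpen_Iio.preimage (continuous_diagonal _ hI).norm,
    ⟨0, by simp⟩, isOpen_Ioi.preimage (continuous_apply 0).norm, ⟨(2 : 𝕜) • unit 0, ?_⟩, ?_⟩
  · simp [unit_apply]
  · rw [Set.disjoint_left]
    rintro n ⟨-, _, ⟨x, hx, rfl⟩, hx'⟩ hn
    simp only [Set.mem_preimage, Set.mem_Iio, Set.mem_Ioi, iterate_apply hB, zero_add] at hx hx'
    have := lp.norm_apply_le_norm ENNReal.top_ne_zero
      (diagonal (𝕜 := 𝕜) (p := p) (I.indicator 1) hI x) n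
    rw [diagonal_apply, Set.indicator_of_mem hn, Pi.one_apply, RCLike.ofReal_one, one_mul] at this
    linarith

theorem isTransitive_iff : IsTransitive B ↔
    ∃ m, liminf (fun j => (V.weight m j : EReal)) atTop = 0 := by
  refine ⟨fun h => ?_, fun ⟨m, hm⟩ => isTransitive_of_liminf hB hm⟩
  by_contra! hcon
  simp_rw [ne_eq, liminf_coe_eq_zero_iff (V.pos _)] at hcon
  push Not at hcon
  -- The eventual lower bound becomes global by including the minimum over the finitely many
  -- remaining indices; the obstruction then applies with `I = ℕ`.
  have hc (m : ℕ) : ∃ c > 0, ∀ j, c ≤ V.weight m j := by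
    obtain ⟨ε, hε, hev⟩ := hcon m
    obtain ⟨N, hN⟩ := eventually_atTop.1 hev
    obtain ⟨i, _, hi⟩ := Finset.exists_min_image (Finset.range (N + 1)) (V.weight m) ⟨0, by simp⟩
    refine ⟨min ε (V.weight m i), lt_min hε (V.pos m i), fun j => ?_⟩
    rcases le_total N j with hj | hj
    · exact (min_le_left _ _).trans (hN j hj)
    · exact (min_le_right _ _).trans (hi j (by simp; omega))
  choose c hc hc' using hc
  obtain ⟨U, W, hU, hU', hW, hW', hd⟩ := exists_returnSet_disjoint (p := p) hB
    (indicator_mem_projectiveWeights (I := Set.univ) hc fun m j _ => hc' m j)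
  obtain ⟨n, hn⟩ := h U W hU hU' hW hW'
  exact Set.disjoint_left.1 hd hn (Set.mem_univ n)

theorem isMixing_iff : IsMixing B ↔ V.HasNullSubsequences := by
  refine ⟨fun h => ?_, isMixing_of_hasNullSubsequences hB⟩
  by_contra hcon
  obtain ⟨I, hI, hu⟩ := exists_indicator_mem_projectiveWeights hcon
  obtain ⟨U, W, hU, hU', hW, hW', hd⟩ := exists_returnSet_disjoint (p := p) hB hu
  refine hI (((h U W hU hU' hW hW').union (Set.finite_singleton 0)).subset fun n hn => ?_)
  rcases Nat.eq_zero_or_pos n with h0 | h0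
  · exact Or.inr h0
  · exact Or.inl ⟨h0, fun h => Set.disjoint_left.1 hd h hn⟩

end CoechelonSpace

end

section

variable {𝕜 : Type*} [RCLike 𝕜] {p : Exponent} {v : ℕ → ℝ}

/-! ### Absolutely summable sequences and a countable dense family -/

theorem mem_weightedSubmodule_of_sum_le {x : ℕ → 𝕜} {δ : ℝ}
    (h : ∀ M, ∑ j ∈ Finset.range M, ‖(v j : 𝕜) * x j‖ ≤ δ) : x ∈ weightedSubmodule 𝕜 p v := by
  have hs : Summable fun j => ‖(v j : 𝕜) * x j‖ :=
    summable_of_sum_range_le (fun _ => norm_nonneg _) h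
  have h1 : Memℓp (weightMul 𝕜 v x) 1 := memℓp_gen (by simpa using hs)
  exact ⟨h1.of_exponent_ge Fact.out,
    fun _ => tendsto_zero_iff_norm_tendsto_zero.2 hs.tendsto_atTop_zero⟩

theorem WeightedSpace.norm_le_of_sum_le {x : WeightedSpace 𝕜 p v} {δ : ℝ}
    (h : ∀ M, ∑ j ∈ Finset.range M, ‖(v j : 𝕜) * x.1 j‖ ≤ δ) : ‖x‖ ≤ δ := by
  refine le_of_tendsto (tendsto_truncate x).norm (Eventually.of_forall fun M => ?_)
  refine (norm_le_sum _ (s := Finset.range M) fun j hj => ?_).trans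
    ((Finset.sum_le_sum fun j hj => ?_).trans (h M))
  · exact truncate_of_le _ (by simpa using hj)
  · change ‖(v j : 𝕜) * truncate M x.1 j‖ ≤ _
    rw [truncate, if_pos (Finset.mem_range.1 hj)]

variable (𝕜) in
/-- The finitely supported sequence with entries from a countable dense set that is coded by a
list. -/
def listSeq (l : List ℕ) (j : ℕ) : 𝕜 := (l.map (TopologicalSpace.denseSeq 𝕜)).getD j 0

theorem listSeq_of_le {l : List ℕ} (j : ℕ) (h : l.length ≤ j) : listSeq 𝕜 l j = 0 := by
  simp [listSeq, List.getElem?_eq_none h]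

theorem WeightedSpace.exists_listSeq_near (x : WeightedSpace 𝕜 p v) {ε : ℝ} (hε : 0 < ε) :
    ∃ l, ‖ofFinite p v (listSeq 𝕜 l) listSeq_of_le - x‖ < ε := by
  obtain ⟨N, hN⟩ := ((tendsto_iff_norm_sub_tendsto_zero.1 (tendsto_truncate x)).eventually_lt_const
    (half_pos hε)).exists
  have hq (j : ℕ) : ∃ q, ‖(v j : 𝕜) * (TopologicalSpace.denseSeq 𝕜 q - x.1 j)‖ <
      ε / 2 / (N + 1) := by
    refine (TopologicalSpace.denseRange_denseSeq 𝕜).exists_mem_open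
      (s := {z | ‖(v j : 𝕜) * (z - x.1 j)‖ < ε / 2 / (N + 1)}) ?_ ⟨x.1 j, ?_⟩
    · exact isOpen_lt (by fun_prop) continuous_const
    · simp only [Set.mem_ofPred_eq, sub_self, mul_zero, norm_zero]; positivity
  choose q hq using hq
  refine ⟨(List.range N).map q, ?_⟩
  have h1 : ‖ofFinite p v (listSeq 𝕜 ((List.range N).map q)) listSeq_of_le -
      ofFinite p v (truncate N x.1) (fun _ => truncate_of_le x.1)‖ ≤ ε / 2 := by
    refine (norm_le_sum _ (s := Finset.range N) fun j hj => ?_).trans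
      ((Finset.sum_le_card_nsmul _ _ (ε / 2 / (N + 1)) fun j hj => ?_).trans ?_)
    · have hj' : N ≤ j := by simpa using hj
      change listSeq 𝕜 _ j - truncate N x.1 j = 0
      rw [listSeq_of_le _ (by simpa using hj'), truncate_of_le _ hj', sub_zero]
    · have hj' := Finset.mem_range.1 hj
      change ‖(v j : 𝕜) * (listSeq 𝕜 _ j - truncate N x.1 j)‖ ≤ _
      rw [show listSeq 𝕜 ((List.range N).map q) j = TopologicalSpace.denseSeq 𝕜 (q j) by
        simp [listSeq, hj'], truncate, if_pos hj']
      exact (hq j).le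
    · rw [Finset.card_range, nsmul_eq_mul, mul_div_assoc', div_le_iff₀ (by positivity)]
      nlinarith
  calc _ ≤ _ := norm_sub_le_norm_sub_add_norm_sub _ (ofFinite p v (truncate N x.1)
        (fun _ => truncate_of_le x.1)) _
    _ < ε := by linarith

/-! ### Hypercyclicity -/

variable {V : WeightSequence}

theorem exists_interval_lt {I : Set ℕ} (hI : IsThick I)
    (h : Tendsto v (atTop ⊓ 𝓟 I) (𝓝 0)) {ε : ℝ} (hε : 0 < ε) (a L : ℕ) :
    ∃ s, a ≤ s ∧ ∀ j, s ≤ j → j ≤ s + L → v j < ε := by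
  obtain ⟨J, hJ⟩ := eventually_atTop.1 (eventually_inf_principal.1 (h.eventually_lt_const hε))
  obtain ⟨i, hi⟩ := hI (max a J + L)
  exact ⟨i + max a J, by omega, fun j h1 h2 => hJ j (by omega) (hi ⟨by omega, by omega⟩)⟩

/-- Positions for the blocks of a hypercyclic vector: the `k`-th block has length `N k`, and the
weight is less than `ε k` on all places where the backward shift moves the block before it
arrives at the origin. -/
theorem exists_positions {I : Set ℕ} (hI : IsThick I) (h : Tendsto v (atTop ⊓ 𝓟 I) (𝓝 0))
    (N : ℕ → ℕ) {ε : ℕ → ℝ} (hε : ∀ k, 0 < ε k) :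
    ∃ n : ℕ → ℕ, n 0 = 0 ∧ (∀ k l, k < l → n k + N k < n l) ∧
      ∀ k l, k < l → ∀ j, n l - n k ≤ j → j ≤ n l + N l → v j < ε l := by
  -- Only the last position `a = n l` matters: among all `k ≤ l`, the difference `b - n k` is
  -- smallest for `k = l`.
  have hF (l a : ℕ) : ∃ b, a + N l < b ∧
      ∀ j, b - a ≤ j → j ≤ b + N (l + 1) → v j < ε (l + 1) := by
    obtain ⟨s, hs, h'⟩ := exists_interval_lt hI h (hε (l + 1)) (N l + 1) (a + N (l + 1))
    exact ⟨s + a, by omega, fun j h1 h2 => h' j (by omega) (by omega)⟩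
  choose F hF1 hF2 using hF
  let n : ℕ → ℕ := fun k => Nat.rec 0 F k
  have hn (k : ℕ) : n (k + 1) = F k (n k) := rfl
  have hstep (k : ℕ) : n k + N k < n (k + 1) := by rw [hn]; exact hF1 _ _
  have hmono : StrictMono n := strictMono_nat_of_lt_succ fun k => by have := hstep k; omega
  refine ⟨n, rfl, fun k l hkl => (hstep k).trans_le (hmono.monotone hkl), fun k l hkl j h1 h2 => ?_⟩
  obtain ⟨l, rfl⟩ : ∃ l', l = l' + 1 := ⟨l - 1, by omega⟩
  have hk : n k ≤ n l := hmono.monotone (by omega)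
  exact hF2 l (n l) j (by rw [← hn]; omega) (by rw [← hn]; exact h2)

/-- The forward shift by `n` places. -/
def shiftRight (n : ℕ) (y : ℕ → 𝕜) (j : ℕ) : 𝕜 := if n ≤ j then y (j - n) else 0

theorem sum_norm_shiftRight_le {y : ℕ → 𝕜} {N d : ℕ} (hy : ∀ j, N ≤ j → y j = 0) {ε : ℝ}
    (hv : ∀ j, 0 ≤ v j) (hε : ∀ j, d ≤ j → j ≤ d + N → v j ≤ ε) (M : ℕ) :
    ∑ j ∈ Finset.range M, ‖(v j : 𝕜) * shiftRight d y j‖ ≤ ε * ∑ i ∈ Finset.range N, ‖y i‖ := by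
  have hsub : Finset.range M ⊆ Finset.range (d + (N + M)) :=
    Finset.range_subset_range.2 (by omega)
  refine (Finset.sum_le_sum_of_subset_of_nonneg hsub fun _ _ _ => norm_nonneg _).trans ?_
  rw [Finset.sum_range_add, Finset.sum_range_add, Finset.mul_sum]
  have h1 : ∑ j ∈ Finset.range d, ‖(v j : 𝕜) * shiftRight d y j‖ = 0 := by
    refine Finset.sum_eq_zero fun j hj => ?_
    rw [shiftRight, if_neg (by simpa using hj), mul_zero, norm_zero]
  have h2 : ∑ j ∈ Finset.range M, ‖(v (d + (N + j)) : 𝕜) * shiftRight d y (d + (N + j))‖ = 0 := by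
    refine Finset.sum_eq_zero fun j hj => ?_
    rw [shiftRight, if_pos (by omega), hy _ (by omega), mul_zero, norm_zero]
  rw [h1, h2, zero_add, add_zero]
  refine Finset.sum_le_sum fun j hj => ?_
  have hj' := Finset.mem_range.1 hj
  rw [shiftRight, if_pos (by omega), Nat.add_sub_cancel_left, norm_mul, RCLike.norm_ofReal,
    abs_of_nonneg (hv _)]
  exact mul_le_mul_of_nonneg_right (hε _ (by omega) (by omega)) (norm_nonneg _)

/-- A sequence composed of finite blocks whose translates to the left, up to the block that
arrives at the origin, are small. -/
theorem exists_block_sequence {I : Set ℕ} (hI : IsThick I) (hv : ∀ j, 0 < v j)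
    (h : Tendsto v (atTop ⊓ 𝓟 I) (𝓝 0)) (y : ℕ → ℕ → 𝕜) (N : ℕ → ℕ)
    (hy : ∀ k j, N k ≤ j → y k j = 0) :
    ∃ (x : ℕ → 𝕜) (n : ℕ → ℕ), n 0 = 0 ∧ ∀ k M,
      ∑ j ∈ Finset.range M, ‖(v j : 𝕜) * (x (j + n k) - y k j)‖ ≤ (1 / 2) ^ k := by
  -- The denominator makes the weighted `ℓ_1`-norm of a moved `k`-th block at most `2^{-k}`; the
  -- summand `1` keeps it positive.
  obtain ⟨n, hn0, hn, hn'⟩ := exists_positions hI h N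
    (ε := fun k => (1 / 2) ^ k / (1 + ∑ i ∈ Finset.range (N k), ‖y k i‖))
    (fun k => by positivity)
  have hmono : StrictMono n := fun k l hkl => by have := hn k l hkl; omega
  -- As `n l ≥ l`, blocks with `l > j` do not reach `j`, so this finite sum is the sum of all
  -- blocks.
  let x : ℕ → 𝕜 := fun j => ∑ l ∈ Finset.range (j + 1), shiftRight (n l) (y l) j
  have hx (j L : ℕ) (hL : j < L) : x j = ∑ l ∈ Finset.range L, shiftRight (n l) (y l) j := by
    refine Finset.sum_subset (Finset.range_subset_range.2 hL) fun l _ hl => if_neg ?_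
    have := hmono.le_apply (x := l)
    have := Finset.mem_range.not.1 hl
    omega
  -- After a shift by `n k` the blocks before `k` are gone, the `k`-th one cancels against `y k`,
  -- and only later blocks remain.
  have hdiff (k j M : ℕ) (hj : j < M) : x (j + n k) - y k j =
      ∑ i ∈ Finset.range (M + n k), shiftRight (n (k + 1 + i) - n k) (y (k + 1 + i)) j := by
    rw [hx (j + n k) (k + 1 + (M + n k)) (by omega), Finset.sum_range_add, Finset.sum_range_succ,
      Finset.sum_eq_zero, zero_add, add_sub_right_comm]
    · rw [shiftRight, if_pos (by omega), Nat.add_sub_cancel, sub_self, zero_add]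
      refine Finset.sum_congr rfl fun i _ => ?_
      have := hmono (show k < k + 1 + i by omega)
      unfold shiftRight
      by_cases hc : n (k + 1 + i) ≤ j + n k
      · rw [if_pos hc, if_pos (by omega)]
        congr 1
        omega
      · rw [if_neg hc, if_neg (by omega)]
    · intro l hl
      have := hn l k (Finset.mem_range.1 hl)
      rw [shiftRight, if_pos (by omega), hy _ _ (by omega)]
  refine ⟨x, n, hn0, fun k M => ?_⟩
  calc ∑ j ∈ Finset.range M, ‖(v j : 𝕜) * (x (j + n k) - y k j)‖
      ≤ ∑ j ∈ Finset.range M, ∑ i ∈ Finset.range (M + n k),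
          ‖(v j : 𝕜) * shiftRight (n (k + 1 + i) - n k) (y (k + 1 + i)) j‖ := by
        refine Finset.sum_le_sum fun j hj => ?_
        rw [hdiff k j M (Finset.mem_range.1 hj), Finset.mul_sum]
        exact norm_sum_le _ _
    _ = ∑ i ∈ Finset.range (M + n k), ∑ j ∈ Finset.range M,
          ‖(v j : 𝕜) * shiftRight (n (k + 1 + i) - n k) (y (k + 1 + i)) j‖ := Finset.sum_comm
    _ ≤ ∑ i ∈ Finset.range (M + n k), (1 / 2 : ℝ) ^ (k + 1 + i) := by
        refine Finset.sum_le_sum fun i _ => ?_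
        refine (sum_norm_shiftRight_le (hy _) (fun j => (hv j).le)
          (fun j h1 h2 => (hn' k (k + 1 + i) (by omega) j h1 (by omega)).le) M).trans ?_
        have hs : 0 ≤ ∑ i' ∈ Finset.range (N (k + 1 + i)), ‖y (k + 1 + i) i'‖ :=
          Finset.sum_nonneg fun _ _ => norm_nonneg _
        rw [div_mul_eq_mul_div, div_le_iff₀ (by positivity)]
        exact mul_le_mul_of_nonneg_left (by linarith) (by positivity)
    _ = (1 / 2) ^ (k + 1) * ∑ i ∈ Finset.range (M + n k), (1 / 2 : ℝ) ^ i := by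
        rw [Finset.mul_sum]
        exact Finset.sum_congr rfl fun i _ => pow_add _ _ _
    _ ≤ (1 / 2) ^ (k + 1) * 2 := by
        refine mul_le_mul_of_nonneg_left ?_ (by positivity)
        have := summable_geometric_two.sum_le_tsum (Finset.range (M + n k))
          (fun _ _ => by positivity)
        rwa [tsum_geometric_two] at this
    _ = (1 / 2) ^ k := by rw [pow_succ]; ring

theorem IsSequentiallyHypercyclic.isHypercyclic {E : Type*} [TopologicalSpace E] {T : E → E}
    (h : IsSequentiallyHypercyclic T) : IsHypercyclic T := by
  obtain ⟨x, hx⟩ := h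
  exact ⟨x, fun z => seqClosure_subset_closure (hx ▸ Set.mem_univ z)⟩

namespace CoechelonSpace

variable {B : CoechelonSpace 𝕜 p V →L[𝕜] CoechelonSpace 𝕜 p V}
  (hB : ∀ (x : CoechelonSpace 𝕜 p V) (j : ℕ), (B x) j = x (j + 1))
include hB

/-- The approximation takes place in the norm of one step containing both the vector and the target,
hence by a sequence. -/
theorem isSequentiallyHypercyclic_of_isThick {m : ℕ} {I : Set ℕ} (hI : IsThick I)
    (h : Tendsto (V.weight m) (atTop ⊓ 𝓟 I) (𝓝 0)) : IsSequentiallyHypercyclic B := by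
  -- Each list is coded by infinitely many `k`, so it can be approximated with arbitrarily small
  -- error `2^{-k}`.
  let code : ℕ → List ℕ := fun k => Denumerable.ofNat (List ℕ) (Nat.unpair k).1
  obtain ⟨x, n, hn0, hx⟩ := exists_block_sequence hI (V.pos m) h (fun k => listSeq 𝕜 (code k))
    (fun k => (code k).length) (fun k => listSeq_of_le)
  have hr (k m' : ℕ) (hm : m ≤ m') (M : ℕ) : ∑ j ∈ Finset.range M,
      ‖(V.weight m' j : 𝕜) * (x (j + n k) - listSeq 𝕜 (code k) j)‖ ≤ (1 / 2) ^ k := by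
    refine (Finset.sum_le_sum fun j _ => ?_).trans (hx k M)
    rw [norm_mul, norm_mul, RCLike.norm_ofReal, RCLike.norm_ofReal, abs_of_pos (V.pos m' j),
      abs_of_pos (V.pos m j)]
    exact mul_le_mul_of_nonneg_right (V.weight_le hm j) (norm_nonneg _)
  let r (k m' : ℕ) (hm : m ≤ m') : WeightedSpace 𝕜 p (V.weight m') :=
    WeightedSpace.mk _ (mem_weightedSubmodule_of_sum_le (hr k m' hm))
  have hrn (k m' : ℕ) (hm : m ≤ m') : ‖r k m' hm‖ ≤ (1 / 2) ^ k :=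
    WeightedSpace.norm_le_of_sum_le (hr k m' hm)
  have hxE : x ∈ coechelonSubmodule 𝕜 p V := by
    refine ⟨m, ?_⟩
    convert (weightedSubmodule 𝕜 p (V.weight m)).add_mem
      (mem_weightedSubmodule_of_finite (x := listSeq 𝕜 (code 0)) listSeq_of_le)
      (mem_weightedSubmodule_of_sum_le (hr 0 m le_rfl))
    ext j
    simp [hn0]
  let X : CoechelonSpace 𝕜 p V := ⟨x, hxE⟩
  refine ⟨X, Set.eq_univ_of_forall fun z => ?_⟩
  obtain ⟨m₁, hm₁⟩ := z.2
  obtain ⟨m', hm, hm'⟩ : ∃ m', m ≤ m' ∧ m₁ ≤ m' := ⟨_, le_max_left _ _, le_max_right _ _⟩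
  let Z : WeightedSpace 𝕜 p (V.weight m') :=
    WeightedSpace.mk z.1 (weightedSubmodule_mono 𝕜 p V hm' hm₁)
  choose l hl using fun i : ℕ => Z.exists_listSeq_near (ε := (1 / 2) ^ i) (by positivity)
  let k : ℕ → ℕ := fun i => Nat.pair (Encodable.encode (l i)) i
  have hcode (i : ℕ) : code (k i) = l i := by simp [code, k]
  let a : ℕ → WeightedSpace 𝕜 p (V.weight m') := fun i =>
    WeightedSpace.ofFinite p _ (listSeq 𝕜 (l i)) listSeq_of_le + r (k i) m' hm
  have ha (i : ℕ) : B^[n (k i)] X = incl 𝕜 p V m' (a i) := by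
    ext j
    rw [iterate_apply hB]
    change x (j + n (k i)) = listSeq 𝕜 (l i) j + (x (j + n (k i)) - listSeq 𝕜 (code (k i)) j)
    rw [hcode, add_sub_cancel]
  refine ⟨fun i => B^[n (k i)] X, fun i => ⟨_, rfl⟩, ?_⟩
  simp_rw [ha]
  refine ((continuous_incl m').tendsto Z).comp (tendsto_iff_norm_sub_tendsto_zero.2 ?_)
  have hlim : Tendsto (fun i : ℕ => (1 / 2 : ℝ) ^ i + (1 / 2) ^ i) atTop (𝓝 0) := by
    have := tendsto_pow_atTop_nhds_zero_of_lt_one (r := (1 / 2 : ℝ)) (by norm_num) (by norm_num)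
    simpa using this.add this
  refine squeeze_zero (fun _ => norm_nonneg _) (fun i => ?_) hlim
  rw [show a i - Z = WeightedSpace.ofFinite p _ (listSeq 𝕜 (l i)) listSeq_of_le - Z +
    r (k i) m' hm from add_sub_right_comm _ _ _]
  refine (norm_add_le _ _).trans (add_le_add (hl i).le ((hrn (k i) m' hm).trans ?_))
  exact pow_le_pow_of_le_one (by norm_num) (by norm_num) (Nat.right_le_pair _ _)

theorem exists_isThick_of_isHypercyclic (h : IsHypercyclic B) :
    ∃ (m : ℕ) (I : Set ℕ), IsThick I ∧ Tendsto (V.weight m) (atTop ⊓ 𝓟 I) (𝓝 0) := by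
  obtain ⟨x, hx⟩ := h
  obtain ⟨m, hm⟩ := x.2
  obtain ⟨C, hC⟩ : ∃ C, C = ‖WeightedSpace.mk x.1 hm‖ := ⟨_, rfl⟩
  have hbound (j : ℕ) : V.weight m j * ‖x j‖ ≤ C := by
    have := WeightedSpace.norm_apply_le (WeightedSpace.mk x.1 hm) j
    rwa [norm_mul, RCLike.norm_ofReal, abs_of_pos (V.pos m j), ← hC] at this
  -- The orbit meets the open set of vectors whose coordinates `0, …, N` all exceed `N + 1` in
  -- modulus.
  have hn (N : ℕ) : ∃ n, ∀ i ≤ N, (N + 1 : ℝ) < ‖x (i + n)‖ := by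
    have hopen : IsOpen {y : CoechelonSpace 𝕜 p V | ∀ i ∈ Finset.range (N + 1),
        (N + 1 : ℝ) < ‖y i‖} := by
      simp only [Set.ofPred_forall]
      exact isOpen_biInter_finset fun i _ => isOpen_lt continuous_const (continuous_apply i).norm
    obtain ⟨_, ⟨n, rfl⟩, hy⟩ := hx.exists_mem_open hopen ⟨ofFinite
      (truncate (N + 1) fun _ => ((N + 2 : ℕ) : 𝕜)) fun _ => truncate_of_le _, fun i hi => by
        change (N + 1 : ℝ) < ‖truncate (N + 1) (fun _ => ((N + 2 : ℕ) : 𝕜)) i‖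
        rw [truncate, if_pos (Finset.mem_range.1 hi), RCLike.norm_natCast]
        push_cast
        linarith⟩
    refine ⟨n, fun i hi => ?_⟩
    have := hy i (Finset.mem_range.2 (by omega))
    rwa [iterate_apply hB] at this
  choose n hn using hn
  refine ⟨m, {j | ∃ N, n N ≤ j ∧ j ≤ n N + N}, fun q => ⟨n q, fun j hj => ⟨q, hj.1, hj.2⟩⟩, ?_⟩
  rw [Metric.tendsto_nhds]
  intro ε hε
  rw [eventually_inf_principal]
  obtain ⟨N₀, hN₀⟩ := exists_nat_gt (C / ε)
  -- Beyond this sum, the intervals with `N < N₀` have ended.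
  filter_upwards [eventually_gt_atTop (∑ N ∈ Finset.range N₀, (n N + N))]
  rintro j hj ⟨N, h1, h2⟩
  have hN : N₀ ≤ N := by
    by_contra hcon
    have := Finset.single_le_sum (f := fun N => n N + N) (fun _ _ => Nat.zero_le _)
      (Finset.mem_range.2 (not_le.1 hcon))
    omega
  rw [Real.dist_0_eq_abs, abs_of_pos (V.pos m j)]
  have h3 := hn N (j - n N) (by omega)
  rw [Nat.sub_add_cancel h1] at h3
  have hN' : (N₀ : ℝ) ≤ N := by exact_mod_cast hN
  rw [div_lt_iff₀ hε] at hN₀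
  by_contra! hcon
  have h4 := hbound j
  have h5 : ε * (N + 1) < V.weight m j * ‖x j‖ :=
    mul_lt_mul' hcon h3 (by positivity) (V.pos m j)
  nlinarith

end CoechelonSpace

end

section

variable {𝕜 : Type*} [RCLike 𝕜] {V : WeightSequence}

/-! ### Compact images of the balls of `ℓ_2` -/

/-- Along an ultrafilter, preimages in the ball converge coordinatewise to a point of the ball. For
the difference, the head is a finite combination of fixed vectors with null coefficients, and the
tail is controlled by `hf`; differences of two points of the ball account for `R + R`. -/
theorem isCompact_image_closedBall {F : Type*} [AddCommGroup F] [Module 𝕜 F] [TopologicalSpace F]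
    [IsTopologicalAddGroup F] [ContinuousSMul 𝕜 F] (f : lp (fun _ : ℕ => 𝕜) 2 →ₗ[𝕜] F) {R : ℝ}
    (hR : 0 ≤ R) (hf : ∀ O ∈ 𝓝 (0 : F), ∃ N : ℕ, ∀ x : lp (fun _ : ℕ => 𝕜) 2, ‖x‖ ≤ R + R →
      (∀ j < N, x j = 0) → f x ∈ O) :
    IsCompact (f '' Metric.closedBall 0 R) := by
  rw [isCompact_iff_ultrafilter_le_nhds']
  intro 𝒰 h𝒰
  have hg (y : F) : ∃ x : lp (fun _ : ℕ => 𝕜) 2, ‖x‖ ≤ R ∧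
      (y ∈ f '' Metric.closedBall 0 R → f x = y) := by
    by_cases hy : y ∈ f '' Metric.closedBall 0 R
    · obtain ⟨x, hx, rfl⟩ := hy
      exact ⟨x, mem_closedBall_zero_iff.1 hx, fun _ => rfl⟩
    · exact ⟨0, by simpa using hR, fun h => absurd h hy⟩
  choose g hg hg' using hg
  have hz (j : ℕ) : ∃ z, Tendsto (fun y => g y j) 𝒰 (𝓝 z) := by
    obtain ⟨z, -, hz⟩ := (isCompact_closedBall (0 : 𝕜) R).ultrafilter_le_nhds
      (𝒰.map fun y => g y j) (tendsto_principal.2 (Eventually.of_forall fun y =>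
        mem_closedBall_zero_iff.2 ((lp.norm_apply_le_norm two_ne_zero _ _).trans (hg y))))
    exact ⟨z, hz⟩
  choose z hz using hz
  have hpi : Tendsto (id fun y => (g y : ℕ → 𝕜)) 𝒰 (𝓝 z) := tendsto_pi_nhds.2 hz
  have hzmem : Memℓp z 2 := lp.memℓp_of_tendsto
    ((Metric.isBounded_closedBall (x := 0) (r := R)).subset
      (Set.range_subset_iff.2 fun y => mem_closedBall_zero_iff.2 (hg y))) hpi
  let Z : lp (fun _ : ℕ => 𝕜) 2 := ⟨z, hzmem⟩
  have hZ : ‖Z‖ ≤ R := lp.norm_le_of_tendsto (Eventually.of_forall hg) hpi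
  refine ⟨f Z, ⟨Z, mem_closedBall_zero_iff.2 hZ, rfl⟩, ?_⟩
  have hlim : Tendsto (fun y => f (g y - Z)) 𝒰 (𝓝 0) := by
    rw [tendsto_def]
    intro O hO
    obtain ⟨O', hO', hadd⟩ := exists_nhds_zero_half hO
    obtain ⟨N, hN⟩ := hf O' hO'
    have hfin : Tendsto (fun y => ∑ j ∈ Finset.range N, (g y j - z j) • f (lp.single 2 j 1)) 𝒰
        (𝓝 0) := by
      rw [show (0 : F) = ∑ j ∈ Finset.range N, (z j - z j) • f (lp.single 2 j 1) by simp]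
      exact tendsto_finsetSum _ fun j _ => ((hz j).sub_const _).smul_const _
    filter_upwards [hfin.eventually hO'] with y hy
    let x := g y - Z
    have hx : ‖x‖ ≤ R + R := (norm_sub_le _ _).trans (add_le_add (hg y) hZ)
    have hs (i : ℕ) : (x - ∑ j ∈ Finset.range N, lp.single 2 j (x j)) i =
        if i < N then 0 else x i := by
      rw [lp.coeFn_sub, Pi.sub_apply, lp_sum_single_apply]
      simp only [Finset.mem_range]
      split_ifs <;> simp
    have htail := hN (x - ∑ j ∈ Finset.range N, lp.single 2 j (x j))
      ((lp.norm_mono two_ne_zero fun i => by rw [hs]; split_ifs <;> simp).trans hx)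
      (fun j hj => by rw [hs, if_pos hj])
    have h := hadd _ hy _ htail
    rw [map_sub, map_sum] at h
    have hsum : ∑ j ∈ Finset.range N, f (lp.single 2 j (x j)) =
        ∑ j ∈ Finset.range N, (g y j - z j) • f (lp.single 2 j 1) := by
      refine Finset.sum_congr rfl fun j _ => ?_
      rw [← map_smul, ← lp.single_smul, smul_eq_mul, mul_one]
      rfl
    rwa [hsum, add_sub_cancel] at h
  have h2 : Tendsto (fun y => f (g y)) 𝒰 (𝓝 (f Z)) := by
    have := hlim.add_const (f Z)
    simpa only [← map_add, sub_add_cancel, zero_add] using this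
  refine Tendsto.congr' (f₁ := fun y => f (g y)) (f₂ := id) ?_ h2
  filter_upwards [h𝒰] with y hy
  exact hg' y hy

/-- The diagonal operator on `ℓ_2` with a bounded symbol. -/
def lpDiagonal (w : ℕ → ℝ) (C : ℝ) (hw : ∀ j, ‖w j‖ ≤ C) :
    lp (fun _ : ℕ => 𝕜) 2 →L[𝕜] lp (fun _ : ℕ => 𝕜) 2 :=
  have h (x : lp (fun _ : ℕ => 𝕜) 2) (j : ℕ) :
      ‖weightMul 𝕜 w x j‖ ≤ ‖((C : 𝕜) • x : lp (fun _ : ℕ => 𝕜) 2) j‖ := by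
    rw [weightMul_apply, norm_mul, lp.coeFn_smul, Pi.smul_apply, norm_smul, RCLike.norm_ofReal,
      RCLike.norm_ofReal]
    exact mul_le_mul_of_nonneg_right ((hw j).trans (le_abs_self C)) (norm_nonneg _)
  LinearMap.mkContinuous
    { toFun := fun x => ⟨weightMul 𝕜 w x, (lp.memℓp ((C : 𝕜) • x)).mono' (h x)⟩
      map_add' := fun x y => Subtype.ext ((weightMul 𝕜 w).map_add x y)
      map_smul' := fun c x => Subtype.ext ((weightMul 𝕜 w).map_smul c x) }
    C fun x => by
      refine (lp.norm_mono two_ne_zero (h x)).trans_eq ?_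
      rw [norm_smul, RCLike.norm_ofReal, abs_of_nonneg ((norm_nonneg _).trans (hw 0))]

theorem lpDiagonal_apply {w : ℕ → ℝ} {C : ℝ} (hw : ∀ j, ‖w j‖ ≤ C) (x : lp (fun _ : ℕ => 𝕜) 2)
    (j : ℕ) : lpDiagonal w C hw x j = (w j : 𝕜) * x j := rfl

theorem isCompact_lpDiagonal_image {w : ℕ → ℝ} {C : ℝ} (hw : ∀ j, ‖w j‖ ≤ C)
    (hw0 : Tendsto w atTop (𝓝 0)) {R : ℝ} (hR : 0 ≤ R) :
    IsCompact (lpDiagonal (𝕜 := 𝕜) w C hw '' Metric.closedBall 0 R) := by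
  refine isCompact_image_closedBall (lpDiagonal w C hw).toLinearMap hR fun O hO => ?_
  obtain ⟨ε, hε, hO⟩ := Metric.mem_nhds_iff.1 hO
  obtain ⟨N, hN⟩ := Metric.tendsto_atTop.1 hw0 (ε / (R + R + 1)) (by positivity)
  refine ⟨N, fun x hx hx0 => hO (mem_ball_zero_iff.2 ?_)⟩
  have h : ‖lpDiagonal w C hw x‖ ≤ ‖((ε / (R + R + 1) : ℝ) : 𝕜) • x‖ := by
    refine lp.norm_mono two_ne_zero fun j => ?_
    rw [lpDiagonal_apply, lp.coeFn_smul, Pi.smul_apply, smul_eq_mul, norm_mul, norm_mul]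
    rcases lt_or_ge j N with hj | hj
    · simp [hx0 j hj]
    · have := (hN j hj).le
      rw [dist_zero_right] at this
      rw [RCLike.norm_ofReal, RCLike.norm_ofReal]
      exact mul_le_mul_of_nonneg_right (this.trans (le_abs_self _)) (norm_nonneg _)
  refine h.trans_lt ?_
  rw [norm_smul, RCLike.norm_ofReal, abs_of_pos (by positivity), div_mul_eq_mul_div,
    div_lt_iff₀ (by positivity)]
  exact mul_lt_mul_of_pos_left (by linarith) hε

/-! ### Consequences of the existence of null subsequences -/

/-- Otherwise take `g m` with `v^(m) > m + 1` at `g m`. By monotonicity `v^(m)` exceeds `1` at `g k`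
for all `k ≥ m`, so no weight has a null subsequence along the infinite range of `g`. -/
theorem WeightSequence.HasNullSubsequences.exists_bounded (h : V.HasNullSubsequences) :
    ∃ m C, ∀ j, V.weight m j ≤ C := by
  by_contra! hcon
  choose g hg using fun m : ℕ => hcon m (m + 1)
  have hI : (Set.range g).Infinite := by
    intro hfin
    obtain ⟨C, hC⟩ := (hfin.image (V.weight 0)).bddAbove
    obtain ⟨m, hm⟩ := exists_nat_gt C
    have h1 := hC ⟨g m, ⟨m, rfl⟩, rfl⟩
    have h2 := V.weight_le (Nat.zero_le m) (g m)
    have h3 := hg m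
    linarith
  have := neBot_atTop_inf_principal hI
  obtain ⟨m, hm⟩ := hasNullSubsequences_iff_liminf.1 h _ hI
  have h1 := frequently_inf_principal.1
    ((liminf_coe_eq_zero_iff (V.pos m)).1 hm 1 one_pos)
  obtain ⟨_, hj, ⟨k, rfl⟩, hk⟩ := frequently_atTop.1 h1 (∑ k ∈ Finset.range m, g k + 1)
  rcases lt_or_ge k m with hkm | hkm
  · have := Finset.single_le_sum (f := g) (fun _ _ => Nat.zero_le _) (Finset.mem_range.2 hkm)
    omega
  · have h2 := V.weight_le hkm (g k)
    have h3 := hg k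
    have h4 : (0 : ℝ) ≤ k := Nat.cast_nonneg k
    linarith

/-- The infimum over `m` of `2^m C_m v^(m)` belongs to `V̄`, hence is null, and `μ j` attains it up
to `1 / (j + 1)`. -/
theorem WeightSequence.HasNullSubsequences.exists_tendsto (h : V.HasNullSubsequences) {C : ℕ → ℝ}
    (hC : ∀ m, 0 < C m) :
    ∃ μ : ℕ → ℕ, Tendsto (fun j => 2 ^ μ j * C (μ j) * V.weight (μ j) j) atTop (𝓝 0) := by
  let w : ℕ → ℕ → ℝ := fun m j => 2 ^ m * C m * V.weight m j
  have hw (m j : ℕ) : 0 < w m j := mul_pos (mul_pos (by positivity) (hC m)) (V.pos m j)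
  have hu : (fun j => ⨅ m, w m j) ∈ projectiveWeights V :=
    ⟨fun j => Real.iInf_nonneg fun m => (hw m j).le, fun m => ⟨2 ^ m * C m,
      mul_pos (by positivity) (hC m), fun j => ciInf_le ⟨0, by
        rintro _ ⟨m, rfl⟩
        exact (hw m j).le⟩ m⟩⟩
  choose μ hμ using fun j : ℕ => exists_lt_of_ciInf_lt (f := fun m => w m j)
    (lt_add_of_pos_right _ (show (0 : ℝ) < 1 / ((j : ℝ) + 1) by positivity))
  refine ⟨μ, squeeze_zero (fun j => (hw _ _).le) (fun j => (hμ j).le) ?_⟩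
  simpa using (hasNullSubsequences_iff_projectiveWeights.1 h _ hu).add
    tendsto_one_div_add_atTop_nhds_zero_nat

/-! ### The inclusion of `ℓ_2` -/

theorem mem_weightedSubmodule_two {v : ℕ → ℝ} {y : ℕ → 𝕜} {x : lp (fun _ : ℕ => 𝕜) 2} {K : ℝ}
    (h : ∀ j, ‖(v j : 𝕜) * y j‖ ≤ K * ‖x j‖) : y ∈ weightedSubmodule 𝕜 Exponent.two v := by
  refine ⟨?_, fun h => absurd h two_ne_zero⟩
  rw [Exponent.normExponent_two]
  refine (lp.memℓp ((K : 𝕜) • x)).mono' fun j => (h j).trans ?_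
  rw [lp.coeFn_smul, Pi.smul_apply, norm_smul, RCLike.norm_ofReal]
  exact mul_le_mul_of_nonneg_right (le_abs_self K) (norm_nonneg _)

theorem WeightedSpace.norm_two_le {v : ℕ → ℝ} {y : WeightedSpace 𝕜 Exponent.two v}
    {x : lp (fun _ : ℕ => 𝕜) 2} {K : ℝ} (hK : 0 ≤ K)
    (h : ∀ j, ‖(v j : 𝕜) * y.1 j‖ ≤ K * ‖x j‖) : ‖y‖ ≤ K * ‖x‖ := by
  have key : ∀ q : ℝ≥0∞, q = 2 → ∀ f : lp (fun _ : ℕ => 𝕜) q, (∀ i, ‖f i‖ ≤ K * ‖x i‖) →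
      ‖f‖ ≤ K * ‖x‖ := by
    rintro q rfl f hf
    rw [← abs_of_nonneg hK, ← RCLike.norm_ofReal (K := 𝕜), ← norm_smul]
    refine lp.norm_mono two_ne_zero fun i => (hf i).trans_eq ?_
    rw [lp.coeFn_smul, Pi.smul_apply, norm_smul, RCLike.norm_ofReal, abs_of_nonneg hK]
  exact key _ Exponent.normExponent_two (WeightedSpace.toLp 𝕜 Exponent.two v y) h

/-- The sum is the midpoint of `z 0` and the same kind of sum for the shifted sequence. -/
theorem Convex.sum_geometric_mem {E : Type*} [AddCommGroup E] [Module ℝ E] {s : Set E}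
    (hs : Convex ℝ s) (h0 : (0 : E) ∈ s) (L : ℕ) (z : ℕ → E) (hz : ∀ m, z m ∈ s) :
    ∑ m ∈ Finset.range L, (1 / 2 : ℝ) ^ (m + 1) • z m ∈ s := by
  induction L generalizing z with
  | zero => simpa using h0
  | succ L ih =>
    rw [Finset.sum_range_succ']
    have h := hs (ih (fun m => z (m + 1)) fun m => hz _) (hz 0) (a := 1 / 2) (b := 1 / 2)
      (by norm_num) (by norm_num) (by norm_num)
    rw [Finset.smul_sum] at h
    simpa only [smul_smul, ← pow_succ', zero_add, pow_one] using h

namespace CoechelonSpace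

theorem exists_isClosed_convex_subset {p : Exponent} {O : Set (CoechelonSpace 𝕜 p V)}
    (hO : O ∈ 𝓝 0) : ∃ O' ∈ 𝓝 (0 : CoechelonSpace 𝕜 p V), IsClosed O' ∧ Convex ℝ O' ∧ O' ⊆ O := by
  obtain ⟨O₁, hO₁, hcl, hsub⟩ := exists_mem_nhds_isClosed_subset hO
  obtain ⟨O₂, ⟨hO₂, hconv⟩, hsub'⟩ :=
    (LocallyConvexSpace.convex_basis_zero ℝ (CoechelonSpace 𝕜 p V)).mem_iff.1 hO₁
  exact ⟨closure O₂, mem_of_superset hO₂ subset_closure, isClosed_closure, hconv.closure,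
    (closure_minimal hsub' hcl).trans hsub⟩

/-- The inclusion of `ℓ_2` into `k_2(V)`, if one of the weights is bounded. -/
def lpIncl {m : ℕ} {C : ℝ} (hC : ∀ j, V.weight m j ≤ C) :
    lp (fun _ : ℕ => 𝕜) 2 →L[𝕜] CoechelonSpace 𝕜 Exponent.two V :=
  have h (x : lp (fun _ : ℕ => 𝕜) 2) (j : ℕ) : ‖(V.weight m j : 𝕜) * x j‖ ≤ C * ‖x j‖ := by
    rw [norm_mul, RCLike.norm_ofReal, abs_of_pos (V.pos m j)]
    exact mul_le_mul_of_nonneg_right (hC j) (norm_nonneg _)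
  let f : lp (fun _ : ℕ => 𝕜) 2 →ₗ[𝕜] WeightedSpace 𝕜 Exponent.two (V.weight m) :=
    { toFun := fun x => WeightedSpace.mk x (mem_weightedSubmodule_two (h x))
      map_add' := fun _ _ => rfl
      map_smul' := fun _ _ => rfl }
  { toLinearMap := incl 𝕜 Exponent.two V m ∘ₗ f
    cont := (continuous_incl m).comp (AddMonoidHomClass.continuous_of_bound f C fun x =>
      WeightedSpace.norm_two_le ((V.pos m 0).le.trans (hC 0)) (h x)) }

theorem lpIncl_apply {m : ℕ} {C : ℝ} (hC : ∀ j, V.weight m j ≤ C) (x : lp (fun _ : ℕ => 𝕜) 2)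
    (j : ℕ) : (lpIncl hC x : CoechelonSpace 𝕜 Exponent.two V) j = x j := rfl

theorem real_smul_apply {p : Exponent} (r : ℝ) (x : CoechelonSpace 𝕜 p V) (j : ℕ) :
    (r • x) j = (r : 𝕜) * x j := RCLike.real_smul_eq_coe_mul r (x j)

theorem isCompact_lpIncl_image (h : V.HasNullSubsequences) {m₀ : ℕ} {C₀ : ℝ}
    (hC₀ : ∀ j, V.weight m₀ j ≤ C₀) :
    IsCompact (lpIncl (𝕜 := 𝕜) hC₀ '' Metric.closedBall 0 1) := by
  refine isCompact_image_closedBall (lpIncl hC₀).toLinearMap zero_le_one fun O hO => ?_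
  obtain ⟨O', hO', hcl, hconv, hsub⟩ := exists_isClosed_convex_subset hO
  have hr (m : ℕ) : ∃ r > 0, ∀ x : WeightedSpace 𝕜 Exponent.two (V.weight m), ‖x‖ < r →
      incl 𝕜 Exponent.two V m x ∈ O' := by
    have h := (continuous_incl (𝕜 := 𝕜) (p := Exponent.two) (V := V) m).tendsto 0
    rw [map_zero] at h
    obtain ⟨r, hr, h⟩ := Metric.mem_nhds_iff.1 (h hO')
    exact ⟨r, hr, fun x hx => h (mem_ball_zero_iff.2 hx)⟩
  choose r hr hr' using hr
  -- The constant `8 / r m` gives `2^{m+1} v^(m)_j ≤ r m / 4` for large `j` with `μ j = m`; with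
  -- `‖x‖ ≤ 2` each rescaled piece has norm at most `r m / 2`.
  obtain ⟨μ, hμ⟩ := h.exists_tendsto (C := fun m => 8 / r m) fun m => div_pos (by norm_num) (hr m)
  obtain ⟨N, hN⟩ := eventually_atTop.1 (hμ.eventually_lt_const one_pos)
  refine ⟨N, fun x hx hx0 => hsub ?_⟩
  refine hcl.mem_of_tendsto (tendsto_truncate (lpIncl hC₀ x)) (Eventually.of_forall fun M => ?_)
  -- The part of the truncation with `μ j = m`, multiplied by `2^{m+1}` to offset its coefficient in
  -- the convex combination.
  let zc : ℕ → ℕ → 𝕜 := fun m j => if μ j = m then ((2 ^ (m + 1) : ℝ) : 𝕜) * truncate M x j else 0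
  have hzc (m j : ℕ) (hj : M ≤ j) : zc m j = 0 := by
    simp only [zc, truncate_of_le _ hj, mul_zero, ite_self]
  have hz (m : ℕ) : (ofFinite (zc m) (hzc m) : CoechelonSpace 𝕜 Exponent.two V) ∈ O' := by
    refine hr' m (WeightedSpace.ofFinite _ _ (zc m) (hzc m)) ?_
    have hle : ‖WeightedSpace.ofFinite Exponent.two (V.weight m) (zc m) (hzc m)‖ ≤
        r m / 4 * ‖x‖ := by
      refine WeightedSpace.norm_two_le (by have := hr m; positivity) fun j => ?_
      change ‖(V.weight m j : 𝕜) * zc m j‖ ≤ _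
      have hrhs : 0 ≤ r m / 4 * ‖x j‖ := by have := hr m; positivity
      by_cases hc : μ j = m ∧ j < M ∧ N ≤ j
      · obtain ⟨h1, h2, h3⟩ := hc
        have h4 := (hN j h3).le
        have h5 := hr m
        simp only [zc, h1, if_true, truncate, h2, norm_mul, RCLike.norm_ofReal,
          abs_of_pos (V.pos m j), ← mul_assoc]
        refine mul_le_mul_of_nonneg_right ?_ (norm_nonneg _)
        rw [h1, mul_div_assoc', div_mul_eq_mul_div, div_le_one h5] at h4
        rw [abs_of_pos (by positivity), pow_succ]
        linarith
      · have : zc m j = 0 := by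
          simp only [zc, truncate]
          split_ifs with h1 h2
          · rw [hx0 j (by by_contra h3; exact hc ⟨h1, h2, not_lt.1 h3⟩), mul_zero]
          · rw [mul_zero]
          · rfl
        simpa [this] using hrhs
    have := hr m
    nlinarith
  -- The number of summands exceeds every `μ j` with `j < M`, so no coordinate is lost.
  have h := Convex.sum_geometric_mem hconv (mem_of_mem_nhds hO')
    (∑ j ∈ Finset.range M, (μ j + 1)) _ hz
  convert h using 1
  ext j
  rw [sum_apply]
  change truncate M x j = _
  have hterm (m : ℕ) : ((1 / 2 : ℝ) ^ (m + 1) • (ofFinite (zc m) (hzc m) :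
      CoechelonSpace 𝕜 Exponent.two V)) j = if μ j = m then truncate M x j else 0 := by
    rw [real_smul_apply]
    change _ * zc m j = _
    simp only [zc, mul_ite, mul_zero, ← mul_assoc, ← RCLike.ofReal_mul, ← mul_pow]
    norm_num
  simp only [hterm, Finset.sum_ite_eq]
  split_ifs with hmem
  · rfl
  · refine truncate_of_le _ (not_lt.1 fun hj => hmem (Finset.mem_range.2 ?_))
    have := Finset.single_le_sum (f := fun j => μ j + 1) (fun _ _ => Nat.zero_le _)
      (Finset.mem_range.2 hj)
    exact this

theorem exists_isCompactOperator (h : V.HasNullSubsequences) :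
    ∃ ι : lp (fun _ : ℕ => 𝕜) 2 →L[𝕜] CoechelonSpace 𝕜 Exponent.two V,
      (∀ x j, (ι x) j = x j) ∧ IsCompactOperator ι := by
  obtain ⟨m, C, hC⟩ := h.exists_bounded
  refine ⟨lpIncl hC, lpIncl_apply hC, _, isCompact_lpIncl_image h hC, ?_⟩
  exact mem_of_superset (Metric.closedBall_mem_nhds 0 one_pos) (Set.subset_preimage_image _ _)

end CoechelonSpace

/-- An ultrafilter replaces a convergent subsequence, since the inductive limit need not be
metrizable. -/
theorem exists_ultrafilter_tendsto {T : Type*} [TopologicalSpace T] {K : Set T} (hK : IsCompact K)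
    {I : Set ℕ} (hI : I.Infinite) {f : ℕ → T} (hf : ∀ j ∈ I, f j ∈ K) :
    ∃ (𝒰 : Ultrafilter ℕ) (z : T), ↑𝒰 ≤ (atTop : Filter ℕ) ∧ I ∈ 𝒰 ∧ Tendsto f 𝒰 (𝓝 z) := by
  have := neBot_atTop_inf_principal hI
  have hle := Ultrafilter.of_le (atTop ⊓ 𝓟 I)
  have hI' : I ∈ Ultrafilter.of (atTop ⊓ 𝓟 I) := hle (mem_inf_of_right (mem_principal_self I))
  obtain ⟨z, -, hz⟩ := hK.ultrafilter_le_nhds' ((Ultrafilter.of (atTop ⊓ 𝓟 I)).map f)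
    (Ultrafilter.mem_map.2 (mem_of_superset hI' hf))
  exact ⟨_, z, hle.trans inf_le_left, hI', hz⟩

/-- Small multiples of `e_j`, `j ∈ I`, would have a limit; coordinatewise it is `0`, yet the
seminorm `sup_{j ∈ I} |x_j|` stays at least `r / 2`. -/
theorem hasNullSubsequences_of_isCompactOperator
    (ι : lp (fun _ : ℕ => 𝕜) 2 →L[𝕜] CoechelonSpace 𝕜 Exponent.two V)
    (hι : ∀ x j, (ι x) j = x j) (hc : IsCompactOperator ι) : V.HasNullSubsequences := by
  by_contra hcon
  obtain ⟨I, hI, hu⟩ := exists_indicator_mem_projectiveWeights hcon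
  obtain ⟨K, hK, hKι⟩ := hc
  obtain ⟨r, hr, hball⟩ := Metric.mem_nhds_iff.1 hKι
  let e : ℕ → lp (fun _ : ℕ => 𝕜) 2 := fun j => lp.single 2 j ((r / 2 : ℝ) : 𝕜)
  have he (j : ℕ) : ‖e j‖ = r / 2 := by
    rw [lp.norm_single two_pos, RCLike.norm_ofReal, abs_of_pos (half_pos hr)]
  obtain ⟨𝒰, z, h𝒰, hI𝒰, hz⟩ := exists_ultrafilter_tendsto hK hI (f := fun j => ι (e j))
    fun j _ => hball (mem_ball_zero_iff.2 (by rw [he]; exact half_lt_self hr))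
  have hz0 : z = 0 := by
    ext i
    refine tendsto_nhds_unique (((CoechelonSpace.continuous_apply i).tendsto z).comp hz)
      (tendsto_const_nhds.congr' ?_)
    filter_upwards [h𝒰 (eventually_gt_atTop i)] with j hj
    exact ((hι _ _).trans (lp.single_apply_ne _ _ _ (ne_of_lt hj))).symm
  have hd := (((CoechelonSpace.continuous_diagonal (𝕜 := 𝕜) (p := Exponent.two) _ hu).norm).tendsto
    z).comp hz
  rw [hz0, map_zero, norm_zero] at hd
  obtain ⟨j, hj, hjI⟩ := ((hd.eventually_lt_const (half_pos hr)).and hI𝒰).exists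
  have h1 := lp.norm_apply_le_norm ENNReal.top_ne_zero
    (CoechelonSpace.diagonal (𝕜 := 𝕜) (p := Exponent.two) _ hu (ι (e j))) j
  rw [CoechelonSpace.diagonal_apply, Set.indicator_of_mem hjI, Pi.one_apply, RCLike.ofReal_one,
    one_mul, hι, lp.single_apply_self, RCLike.norm_ofReal, abs_of_pos (half_pos hr)] at h1
  exact absurd hj (not_lt.2 h1)

end

section

variable {𝕜 : Type*} [RCLike 𝕜] {V : WeightSequence}

/-! ### The echelon space of order two -/

namespace EchelonSpace

variable {A : ℕ → ℕ → ℝ}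

theorem continuous_toLp (m : ℕ) : Continuous (toLp 𝕜 A m) :=
  continuous_iInf_dom (i := m) continuous_induced_dom

theorem isVonNBounded_iff {S : Set (EchelonSpace 𝕜 A)} :
    Bornology.IsVonNBounded 𝕜 S ↔ ∀ m, ∃ R, ∀ x ∈ S, ‖toLp 𝕜 A m x‖ ≤ R := by
  have hm (m : ℕ) : (∃ R, ∀ x ∈ S, ‖toLp 𝕜 A m x‖ ≤ R) ↔
      Bornology.IsVonNBounded 𝕜 (toLp 𝕜 A m '' S) := by
    rw [NormedSpace.isVonNBounded_iff, isBounded_iff_forall_norm_le]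
    simp only [Set.forall_mem_image]
  simp_rw [hm]
  refine ⟨fun h m => h.image (⟨toLp 𝕜 A m, continuous_toLp m⟩ : EchelonSpace 𝕜 A →L[𝕜] _),
    fun h => ?_⟩
  simp_rw [Bornology.isVonNBounded_iff_tendsto_smallSets_nhds] at h ⊢
  rw [nhds_iInf]
  simp_rw [nhds_induced, smallSets_iInf, smallSets_comap_eq_comap_image, tendsto_iInf,
    tendsto_comap_iff, map_zero]
  refine fun m => (h m).congr fun c => ?_
  exact (Set.image_smul_comm _ _ _ fun x => map_smul (toLp 𝕜 A m) c x).symm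

theorem toLp_apply (m : ℕ) (x : EchelonSpace 𝕜 A) (j : ℕ) :
    toLp 𝕜 A m x j = (A m j : 𝕜) * x j := rfl

/-- The unit vectors. -/
def unit (j : ℕ) : EchelonSpace 𝕜 A := ⟨(lp.single 2 j 1 : lp (fun _ : ℕ => 𝕜) 2), fun m => by
  convert lp.memℓp (lp.single (E := fun _ : ℕ => 𝕜) 2 j (A m j : 𝕜)) using 1
  ext i
  rw [weightMul_apply]
  rcases eq_or_ne i j with rfl | hij
  · rw [lp.single_apply_self, lp.single_apply_self, mul_one]
  · rw [lp.single_apply_ne _ _ _ hij, lp.single_apply_ne _ _ _ hij, mul_zero]⟩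

theorem toLp_unit (m j : ℕ) : toLp 𝕜 A m (unit j) = lp.single 2 j (A m j : 𝕜) := by
  refine lp.ext (funext fun i => ?_)
  change (A m i : 𝕜) * (lp.single 2 j 1 : lp (fun _ : ℕ => 𝕜) 2) i = _
  rcases eq_or_ne i j with rfl | hij
  · rw [lp.single_apply_self, lp.single_apply_self, mul_one]
  · rw [lp.single_apply_ne _ _ _ hij, lp.single_apply_ne _ _ _ hij, mul_zero]

/-- An indicator in `V̄` makes the unit vectors indexed by `I` bounded in `λ_2(A(V))`; in `ℓ_2` they
have norm one and tend to `0` coordinatewise. -/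
theorem hasNullSubsequences_of_isMontelMap
    (ι : EchelonSpace 𝕜 (koetheMatrix V) →L[𝕜] lp (fun _ : ℕ => 𝕜) 2)
    (hι : ∀ x j, (ι x) j = x j) (hM : IsMontelMap ι) : V.HasNullSubsequences := by
  by_contra hcon
  obtain ⟨I, hI, hu⟩ := exists_indicator_mem_projectiveWeights hcon
  have hS : Bornology.IsVonNBounded 𝕜 ((unit : ℕ → EchelonSpace 𝕜 (koetheMatrix V)) '' I) := by
    refine isVonNBounded_iff.2 fun m => ?_
    obtain ⟨α, hα, h⟩ := hu.2 m
    refine ⟨α, ?_⟩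
    rintro _ ⟨j, hj, rfl⟩
    have h1 := h j
    rw [Set.indicator_of_mem hj, Pi.one_apply] at h1
    rw [toLp_unit, lp.norm_single two_pos, RCLike.norm_ofReal, koetheMatrix,
      abs_of_pos (one_div_pos.2 (V.pos m j)), div_le_iff₀ (V.pos m j)]
    exact h1
  obtain ⟨𝒰, z, h𝒰, hI𝒰, hz⟩ := exists_ultrafilter_tendsto (hM _ hS) hI (f := fun j => ι (unit j))
    fun j hj => subset_closure ⟨_, ⟨j, hj, rfl⟩, rfl⟩
  have hι' (j : ℕ) : ι (unit j) = lp.single 2 j 1 := lp.ext (funext fun i => hι _ i)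
  simp_rw [hι'] at hz
  have hz0 : z = 0 := by
    refine lp.ext (funext fun i => ?_)
    refine tendsto_nhds_unique
      (((lp.lipschitzWith_one_eval (E := fun _ : ℕ => 𝕜) 2 i).continuous.tendsto z).comp hz)
      (tendsto_const_nhds.congr' ?_)
    filter_upwards [h𝒰 (eventually_gt_atTop i)] with j hj
    exact (lp.single_apply_ne (E := fun _ : ℕ => 𝕜) 2 j 1 (ne_of_lt hj)).symm
  have hd := hz.norm
  simp_rw [lp.norm_single two_pos, norm_one, hz0, norm_zero] at hd
  exact one_ne_zero (tendsto_nhds_unique tendsto_const_nhds hd)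

theorem norm_lpDiagonal_symbol {m : ℕ} {C : ℝ} (hC : ∀ j, V.weight m j ≤ C) (j : ℕ) :
    ‖V.weight m j‖ ≤ C := by
  rw [Real.norm_of_nonneg (V.pos m j).le]
  exact hC j

/-- The inclusion of `λ_2(A(V))` into `ℓ_2`, if one of the weights is bounded. -/
def inclLp {m : ℕ} {C : ℝ} (hC : ∀ j, V.weight m j ≤ C) :
    EchelonSpace 𝕜 (koetheMatrix V) →L[𝕜] lp (fun _ : ℕ => 𝕜) 2 :=
  lpDiagonal (V.weight m) C (norm_lpDiagonal_symbol hC) ∘L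
    ⟨toLp 𝕜 (koetheMatrix V) m, continuous_toLp m⟩

theorem ofReal_mul_koetheMatrix_mul (V : WeightSequence) (m j : ℕ) (a : 𝕜) :
    (V.weight m j : 𝕜) * ((koetheMatrix V m j : 𝕜) * a) = a := by
  rw [← mul_assoc, ← RCLike.ofReal_mul, koetheMatrix, mul_one_div_cancel (V.pos m j).ne',
    RCLike.ofReal_one, one_mul]

theorem inclLp_apply {m : ℕ} {C : ℝ} (hC : ∀ j, V.weight m j ≤ C)
    (x : EchelonSpace 𝕜 (koetheMatrix V)) (j : ℕ) : inclLp hC x j = x j :=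
  ofReal_mul_koetheMatrix_mul V m j (x j)

/-- On the level set `μ j = m` the sum is at most `4^{-m} ≤ 2^{-m}`, and the level sets add up to at
most `2`. -/
theorem sum_norm_div_sq_le {x : EchelonSpace 𝕜 (koetheMatrix V)} {R : ℕ → ℝ} (hR : ∀ m, 0 < R m)
    (hx : ∀ m, ‖toLp 𝕜 (koetheMatrix V) m x‖ ≤ R m) (μ : ℕ → ℕ) (s : Finset ℕ) :
    ∑ j ∈ s, (‖x j‖ / (2 ^ μ j * R (μ j) * V.weight (μ j) j)) ^ 2 ≤ 2 := by
  have hinner (m : ℕ) : ∑ j ∈ s with μ j = m,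
      (‖x j‖ / (2 ^ μ j * R (μ j) * V.weight (μ j) j)) ^ 2 ≤ (1 / 2) ^ m := by
    have h1 := (lp.sum_rpow_le_norm_rpow (by simp) (toLp 𝕜 (koetheMatrix V) m x)
      {j ∈ s | μ j = m}).trans (Real.rpow_le_rpow (norm_nonneg _) (hx m) (by simp))
    simp only [ENNReal.toReal_ofNat, Real.rpow_two] at h1
    have h2 : ∑ j ∈ s with μ j = m, (‖x j‖ / (2 ^ μ j * R (μ j) * V.weight (μ j) j)) ^ 2 =
        (∑ j ∈ s with μ j = m, ‖toLp 𝕜 (koetheMatrix V) m x j‖ ^ 2) / (2 ^ m * R m) ^ 2 := by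
      rw [Finset.sum_div]
      refine Finset.sum_congr rfl fun j hj => ?_
      rw [(Finset.mem_filter.1 hj).2, toLp_apply, norm_mul, RCLike.norm_ofReal, koetheMatrix,
        abs_of_pos (one_div_pos.2 (V.pos m j)), ← div_pow]
      congr 1
      have := V.pos m j
      have := hR m
      field_simp
    rw [h2, div_le_iff₀ (by have := hR m; positivity)]
    refine h1.trans ?_
    have h3 : (1 : ℝ) ≤ 2 ^ m := one_le_pow₀ one_le_two
    rw [one_div, inv_pow, inv_mul_eq_div, le_div_iff₀ (by positivity)]
    have h4 : (2 ^ m : ℝ) ≤ 2 ^ m * 2 ^ m := le_mul_of_one_le_left (by positivity) h3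
    calc R m ^ 2 * 2 ^ m ≤ R m ^ 2 * (2 ^ m * 2 ^ m) := by gcongr
      _ = _ := by ring
  rw [← Finset.sum_fiberwise_of_maps_to (t := s.image μ) fun j hj => Finset.mem_image_of_mem μ hj]
  refine (Finset.sum_le_sum fun m _ => hinner m).trans ?_
  exact (summable_geometric_two.sum_le_tsum _ fun _ _ => by positivity).trans_eq
    tsum_geometric_two

theorem exists_isMontelMap (h : V.HasNullSubsequences) :
    ∃ ι : EchelonSpace 𝕜 (koetheMatrix V) →L[𝕜] lp (fun _ : ℕ => 𝕜) 2,
      (∀ x j, (ι x) j = x j) ∧ IsMontelMap ι := by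
  obtain ⟨m, C, hC⟩ := h.exists_bounded
  refine ⟨inclLp hC, inclLp_apply hC, fun S hS => ?_⟩
  choose R hR using isVonNBounded_iff.1 hS
  have hR' (m : ℕ) : 0 < max (R m) 1 := lt_max_of_lt_right one_pos
  obtain ⟨μ, hμ⟩ := h.exists_tendsto hR'
  let w : ℕ → ℝ := fun j => 2 ^ μ j * max (R (μ j)) 1 * V.weight (μ j) j
  have hw (j : ℕ) : 0 < w j := mul_pos (mul_pos (by positivity) (hR' _)) (V.pos _ j)
  obtain ⟨D, hD⟩ := (Metric.isBounded_range_of_tendsto w hμ).exists_norm_le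
  have hD' (j : ℕ) : ‖w j‖ ≤ D := hD _ ⟨j, rfl⟩
  -- Each `x ∈ S` is `w` times a sequence of squared norm at most `2`, so the ball of radius `2`
  -- suffices.
  refine (isCompact_lpDiagonal_image (𝕜 := 𝕜) hD' hμ zero_le_two).closure_of_subset ?_
  rintro _ ⟨x, hx, rfl⟩
  have hsum (s : Finset ℕ) : ∑ j ∈ s, ‖((w j)⁻¹ : 𝕜) * x j‖ ^ (2 : ℝ≥0∞).toReal ≤ 2 := by
    refine le_trans (le_of_eq (Finset.sum_congr rfl fun j _ => ?_)) (sum_norm_div_sq_le hR'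
      (fun m => (hR m x hx).trans (le_max_left _ _)) μ s)
    rw [norm_mul, norm_inv, RCLike.norm_ofReal, abs_of_pos (hw j), ENNReal.toReal_ofNat,
      Real.rpow_two, inv_mul_eq_div]
  let y : lp (fun _ : ℕ => 𝕜) 2 := ⟨fun j => ((w j)⁻¹ : 𝕜) * x j, memℓp_gen' hsum⟩
  refine ⟨y, mem_closedBall_zero_iff.2 (lp.norm_le_of_forall_sum_le (by simp) zero_le_two
    fun s => (hsum s).trans ?_), lp.ext (funext fun j => ?_)⟩
  · rw [ENNReal.toReal_ofNat, Real.rpow_two]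
    norm_num
  · rw [lpDiagonal_apply, inclLp_apply]
    exact mul_inv_cancel_left₀ (RCLike.ofReal_ne_zero.2 (hw j).ne') _

end EchelonSpace

end

end Koethe

end

/-! ### Assembly of the characterisations -/

open Koethe in
theorem mainTheorem1 {𝕜 : Type*} [RCLike 𝕜] (p : Koethe.Exponent) (V : Koethe.WeightSequence)
    (B : Koethe.CoechelonSpace 𝕜 p V →L[𝕜] Koethe.CoechelonSpace 𝕜 p V)
    (hB : ∀ (x : Koethe.CoechelonSpace 𝕜 p V) (j : ℕ), (B x) j = x (j + 1)) :
    -- (a)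
    (Koethe.IsTransitive B ↔
      ∃ m, liminf (fun j => (V.weight m j : EReal)) atTop = 0) ∧
    -- (b)
    [Koethe.IsSequentiallyHypercyclic B,
      Koethe.IsHypercyclic B,
      ∃ (m : ℕ) (I : Set ℕ), Koethe.IsThick I ∧
        Tendsto (V.weight m) (atTop ⊓ 𝓟 I) (𝓝 0)].TFAE ∧
    -- (c)
    [Koethe.IsMixing B,
      ∀ I : Set ℕ, I.Infinite →
        ∃ m, liminf (fun j => (V.weight m j : EReal)) (atTop ⊓ 𝓟 I) = 0,
      ∀ u ∈ Koethe.projectiveWeights V, Tendsto u atTop (𝓝 0),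
      ∃ ι : lp (fun _ : ℕ => 𝕜) 2 →L[𝕜] Koethe.CoechelonSpace 𝕜 Koethe.Exponent.two V,
        (∀ x j, (ι x) j = x j) ∧ IsCompactOperator ι,
      ∃ ι : Koethe.EchelonSpace 𝕜 (Koethe.koetheMatrix V) →L[𝕜] lp (fun _ : ℕ => 𝕜) 2,
        (∀ x j, (ι x) j = x j) ∧ Koethe.IsMontelMap ι].TFAE ∧
    -- (d)
    ((∃ m, ∀ ε : ℝ, 0 < ε → Koethe.IsSyndetic {j | V.weight m j < ε}) →
      Koethe.IsTopologicallyErgodic B) := by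
  refine ⟨CoechelonSpace.isTransitive_iff hB, ?_, ?_,
    fun ⟨m, hm⟩ => CoechelonSpace.isTopologicallyErgodic_of_isSyndetic hB hm⟩
  · tfae_have 1 → 2 := IsSequentiallyHypercyclic.isHypercyclic
    tfae_have 2 → 3 := CoechelonSpace.exists_isThick_of_isHypercyclic hB
    tfae_have 3 → 1 := fun ⟨m, I, hI, h⟩ =>
      CoechelonSpace.isSequentiallyHypercyclic_of_isThick hB hI h
    tfae_finish
  · rw [← hasNullSubsequences_iff_liminf, ← hasNullSubsequences_iff_projectiveWeights]
    tfae_have 1 ↔ 2 := CoechelonSpace.isMixing_iff hB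
    tfae_have 2 ↔ 3 := Iff.rfl
    tfae_have 2 → 4 := CoechelonSpace.exists_isCompactOperator
    tfae_have 4 → 2 := fun ⟨ι, hι, h⟩ => hasNullSubsequences_of_isCompactOperator ι hι h
    tfae_have 2 → 5 := EchelonSpace.exists_isMontelMap
    tfae_have 5 → 2 := fun ⟨ι, hι, h⟩ => EchelonSpace.hasNullSubsequences_of_isMontelMap ι hι h
    tfae_finish
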